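/- **Setting.** Let $S$ and $A$ be Polish spaces, $P(ds'|s,a)$ a probability kernel from $S\times A$ to $S$, $c_0:S\times A\to\mathbb R$ a bounded measurable cost, $\gamma\in(0,1)$, $\mu\in\mathcal P(A)$ and $\tau>0$. For a policy $\pi\in\mathcal P(A|S)$ (a probability kernel from $S$ to $A$) let $$V^\pi_\tau(s)=\mathbb E^\pi_s\Big[\sum_{n\ge 0}\gamma^n\big(c_0(s_n,a_n)+\tau\,\mathrm{KL}(\pi(\cdot|s_n)|\mu)\big)\Big]\in\mathbb R\cup\{+\infty\},\qquad V^\pi_\tau(\rho)=\int_S V^\pi_\tau\,d\rho ,$$ where $s_0=s$, $a_n\sim\pi(\cdot|s_n)$, $s_{n+1}\sim P(\cdot|s_n,a_n)$. Let $\Pi_\mu$ be the set of policies of the form $\pi(da|s)=e^{f(s,a)}\mu(da)/\int_A e^{f(s,a')}\mu(da')$ with $f$ bounded and measurable, and for $\pi\in\Pi_\mu$ put $Q^\pi_\tau(s,a)=c_0(s,a)+\gamma\int_S V^\pi_\tau(s')P(ds'|s,a)$. Write $P_\pi(ds'|s)=\int_A P(ds'|s,a)\pi(da|s)$, $P^\pi(ds',da'|s,a)=P(ds'|s,a)\pi(da'|s')$,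 and for $\rho\in\mathcal P(S)$, $\beta\in\mathcal P(S\times A)$ define the occupancy measures $$d^\pi_\rho=(1-\gamma)\sum_{n\ge0}\gamma^n\rho P_\pi^n,\qquad d^\pi_\beta=(1-\gamma)\sum_{n\ge0}\gamma^n\beta (P^\pi)^n .$$ Let $\phi:S\times A\to\mathbb R^N$ be measurable, $Q(s,a;\theta)=\langle\theta,\phi(s,a)\rangle$, and $$T^\pi_\tau f(s,a)=c_0(s,a)+\gamma\int f\,dP^\pi(\cdot|s,a)+\tau\gamma\int_S\mathrm{KL}(\pi(\cdot|s')|\mu)P(ds'|s,a),$$ $$g(\theta,\pi)=\int_{S\times A}\big(Q(s,a;\theta)-T^\pi_\tau Q(\cdot;\theta)(s,a)\big)\phi(s,a)\,d^\pi_\beta(ds,da),$$ $$A(s,a;\theta,\pi)=Q(s,a;\theta)+\tau\ln\tfrac{d\pi}{d\mu}(s,a)-\int_A\Big(Q(s,a';\theta)+\tau\ln\tfrac{d\pi}{d\mu}(s,a')\Big)\pi(da'|s).$$ **Algorithm (double-loop actor-critic).** Given step sizes $h,\lambda>0$, numbers $M(n)\in\mathbb N$, $\theta^0\in\mathbb R^N$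 and $\pi^0\in\Pi_\mu$, for $n=0,1,2,\dots$: put $\theta^{n,0}=\theta^n$, $\theta^{n,k}=\theta^{n,k-1}-h\,g(\theta^{n,k-1},\pi^n)$ for $1\le k\le M(n)$, $\theta^{n+1}=\theta^{n,M(n)}$, and let $\pi^{n+1}\in\Pi_\mu$ minimise over $\pi\in\Pi_\mu$ $$\tilde G(\pi,\pi^n,\theta^{n+1})=\int_S\Big(\int_A A(s,a;\theta^{n+1},\pi^n)\pi(da|s)+\tfrac1\lambda\mathrm{KL}(\pi|\pi^n)(s)\Big)d^{\pi^n}_\rho(ds),$$ where the minimiser is taken to be the one that minimises the bracket over $\Pi_\mu$ at every $s\in S$. **Theorem.** Assume: 1. ($Q^\pi_\tau$-realisability) for every $\pi\in\Pi_\mu$ there is $\theta_\pi\in\mathbb R^N$ with $Q^\pi_\tau(s,a)=\langle\theta_\pi,\phi(s,a)\rangle$ for all $(s,a)$; 2. $\beta\in\mathcal P(S\times A)$ and $\lambda_\beta:=\lambda_{\min}\big(\int\phi\phi^\top d\beta\big)>0$; 3. $|\phi(s,a)|_2\le1$ for all $(s,a)$; 4. $\rho\in\mathcal P(S)$, and $\pi^*\in\mathcal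 P(A|S)$ is optimal, i.e. $V^{\pi^*}_\tau(\rho)=\inf_{\pi\in\mathcal P(A|S)}V^\pi_\tau(\rho)$; 5. $d^{\pi^*}_\rho\ll\rho$ and $\frac{d\,d^{\pi^*}_\rho}{d\rho}\le\xi<\infty$ ($\rho$-a.e.); 6. with $\Gamma=(1-\gamma)(1-\sqrt\gamma)\lambda_\beta$, $0<h<\frac{\Gamma}{2(1+\gamma)}$; 7. $\lambda>0$ and $0\le 1-\tau\lambda\le\frac{\xi-1}{\xi}$; 8. $c>0$ and $M(n)\ge\frac{4c}{h\Gamma}(n+1)$ for all $n\in\mathbb N$. Then $V^{\pi^*}_\tau(\rho)<\infty$, and for all iterates $(\theta^n,\pi^n)$ of the algorithm there exists $b\ge0$ such that for all $n\in\mathbb N$ $$V^{\pi^n}_\tau(\rho)-V^{\pi^*}_\tau(\rho)\le b\,e^{-\min\{1/\xi,\;c\}\,n}.$$ -/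

import Mathlib

open MeasureTheory ProbabilityTheory
open scoped ENNReal RealInnerProductSpace

noncomputable section

/-- An entropy-regularised, infinite-horizon, discounted Markov decision process with transition
kernel `P(ds'|s,a)`, bounded measurable cost `c`, discount factor `γ ∈ (0,1)`, reference
probability measure `μ` on the actions and regularisation parameter `τ > 0`. -/
structure EntropyMDP (S A : Type*) [MeasurableSpace S] [MeasurableSpace A] where
  P : Kernel (S × A) S
  markov : IsMarkovKernel P
  cost : S × A → ℝ
  cost_measurable : Measurable cost
  cost_bounded : ∃ C : ℝ, ∀ x, |cost x| ≤ C
  γ : ℝ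
  γ_pos : 0 < γ
  γ_lt_one : γ < 1
  μ : Measure A
  μ_prob : IsProbabilityMeasure μ
  τ : ℝ
  τ_pos : 0 < τ

attribute [instance] EntropyMDP.markov EntropyMDP.μ_prob

/-- The set `𝒫(A|S)` of stochastic policies: Markov kernels from states to actions. -/
abbrev Policy (S A : Type*) [MeasurableSpace S] [MeasurableSpace A] : Type _ :=
  {π : Kernel S A // IsMarkovKernel π}

instance Policy.isMarkovKernel {S A : Type*} [MeasurableSpace S] [MeasurableSpace A]
    (π : Policy S A) : IsMarkovKernel π.1 := π.2

/-- `d_ν = (1 - γ) ∑ₙ γⁿ ν κⁿ`, the normalised discounted occupancy measure of the Markov chain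
with initial law `ν` and transition kernel `κ`. -/
def occupancy {E : Type*} [MeasurableSpace E] (γ : ℝ) (κ : Kernel E E) (ν : Measure E) :
    Measure E :=
  Measure.sum fun n : ℕ =>
    ENNReal.ofReal ((1 - γ) * γ ^ n) • ((fun m : Measure E => m.bind κ)^[n] ν)

/-- The feature covariance matrix `∫ φ φᵀ dβ`. -/
def featureCov {E : Type*} [MeasurableSpace E] {N : ℕ} (φ : E → EuclideanSpace ℝ (Fin N))
    (β : Measure E) : Matrix (Fin N) (Fin N) ℝ :=
  Matrix.of fun i j => ∫ x, φ x i * φ x j ∂β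

theorem featureCov_isHermitian {E : Type*} [MeasurableSpace E] {N : ℕ}
    (φ : E → EuclideanSpace ℝ (Fin N)) (β : Measure E) : (featureCov φ β).IsHermitian := by
  ext i j
  simp [featureCov, mul_comm]

/-- `λ_β`, the smallest eigenvalue of `∫ φ φᵀ dβ` (it takes the value `0` when `N = 0`). -/
def minEigenvalue {E : Type*} [MeasurableSpace E] {N : ℕ} (φ : E → EuclideanSpace ℝ (Fin N))
    (β : Measure E) : ℝ :=
  ⨅ i, (featureCov_isHermitian φ β).eigenvalues i

namespace EntropyMDP

variable {S A : Type*} [MeasurableSpace S] [MeasurableSpace A] (m : EntropyMDP S A)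

/-- `P_π(ds'|s) = ∫ P(ds'|s,a) π(da|s)`. -/
def stateKernel (π : Policy S A) : Kernel S S := (π.1 ⊗ₖ m.P).snd

/-- `P^π(ds',da'|s,a) = P(ds'|s,a) π(da'|s')`. -/
def stateActionKernel (π : Policy S A) : Kernel (S × A) (S × A) :=
  m.P ⊗ₖ Kernel.prodMkLeft (S × A) π.1

instance (π : Policy S A) : IsMarkovKernel (m.stateActionKernel π) := by
  unfold stateActionKernel; infer_instance

/-- The law of the trajectory `(s₀,a₀), (s₁,a₁), …` with `s₀ = s`, `aₙ ∼ π(·|sₙ)` and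
`sₙ₊₁ ∼ P(·|sₙ,aₙ)`. -/
def pathLaw (π : Policy S A) (s : S) : Measure (ℕ → S × A) :=
  Kernel.trajMeasure (X := fun _ => S × A) ((π.1 s).map fun a => (s, a))
    fun n => (m.stateActionKernel π).comap (fun x => x ⟨n, Finset.mem_Iic.2 le_rfl⟩)
      (measurable_pi_apply _)

/-- `KL(π(·|s) | μ)` with values in `[0,∞]`. -/
def kl (π : Policy S A) (s : S) : ℝ≥0∞ := InformationTheory.klDiv (π.1 s) m.μ

/-- `𝔼_s^π ∑ₙ γⁿ c(sₙ,aₙ)`. -/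
def costValue (π : Policy S A) (s : S) : ℝ :=
  ∫ ω, ∑' n : ℕ, m.γ ^ n * m.cost (ω n) ∂m.pathLaw π s

/-- `𝔼_s^π ∑ₙ γⁿ τ KL(π(·|sₙ) | μ)`, with values in `[0,∞]`. -/
def entropyValue (π : Policy S A) (s : S) : ℝ≥0∞ :=
  ∫⁻ ω, ∑' n : ℕ, ENNReal.ofReal (m.γ ^ n * m.τ) * m.kl π (ω n).1 ∂m.pathLaw π s

/-- The regularised value function
`V^π_τ(s) = 𝔼_s^π ∑ₙ γⁿ (c(sₙ,aₙ) + τ KL(π(·|sₙ) | μ)) ∈ ℝ ∪ {+∞}`. The discounted cost is bounded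
and the discounted divergence is nonnegative, so the expectation is the sum of the two parts. -/
def value (π : Policy S A) (s : S) : EReal := (m.costValue π s : EReal) + (m.entropyValue π s : EReal)

/-- `V^π_τ(ρ) = ∫ V^π_τ dρ ∈ ℝ ∪ {+∞}`, again as bounded part plus nonnegative part. -/
def valueAt (π : Policy S A) (ρ : Measure S) : EReal :=
  ((∫ s, m.costValue π s ∂ρ : ℝ) : EReal) + ((∫⁻ s, m.entropyValue π s ∂ρ : ℝ≥0∞) : EReal)

/-- `π` is optimal for the initial law `ρ`: `V^π_τ(ρ) = inf_{π' ∈ 𝒫(A|S)} V^{π'}_τ(ρ)`. -/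
def IsOptimal (π : Policy S A) (ρ : Measure S) : Prop :=
  m.valueAt π ρ = ⨅ π' : Policy S A, m.valueAt π' ρ

/-- The class `Π_μ` of policies `π(da|s) = exp(f(s,a)) μ(da) / ∫ exp(f(s,a')) μ(da')` with `f`
bounded and measurable. -/
def admissible : Set (Policy S A) :=
  {π | ∃ f : S × A → ℝ, Measurable f ∧ (∃ C : ℝ, ∀ x, |f x| ≤ C) ∧
    ∀ s, π.1 s = m.μ.tilted fun a => f (s, a)}

/-- `Q^π_τ(s,a) = c(s,a) + γ ∫ V^π_τ(s') P(ds'|s,a)` (used for `π ∈ Π_μ`, where `V^π_τ` is real). -/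
def qValue (π : Policy S A) (x : S × A) : ℝ :=
  m.cost x + m.γ * ∫ s', (m.value π s').toReal ∂m.P x

/-- The Bellman operator
`T^π_τ f(s,a) = c(s,a) + γ ∫ f dP^π(·|s,a) + τ γ ∫ KL(π(·|s')|μ) P(ds'|s,a)`
(used for `π ∈ Π_μ`, where the divergence is bounded). -/
def bellman (π : Policy S A) (f : S × A → ℝ) (x : S × A) : ℝ :=
  m.cost x + m.γ * ∫ y, f y ∂m.stateActionKernel π x
    + m.τ * m.γ * ∫ s', (m.kl π s').toReal ∂m.P x

variable {N : ℕ} (φ : S × A → EuclideanSpace ℝ (Fin N)) (β : Measure (S × A))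

/-- `Q^π_τ`-realisability: for every `π ∈ Π_μ`, `Q^π_τ = ⟨θ_π, φ⟩` for some `θ_π`. -/
def Realisable : Prop :=
  ∀ π ∈ m.admissible, ∃ θ : EuclideanSpace ℝ (Fin N), ∀ x, m.qValue π x = ⟪θ, φ x⟫

/-- The semi-gradient
`g(θ,π) = ∫ (Q(s,a;θ) - T^π_τ Q(s,a;θ)) φ(s,a) d^π_β(ds,da)`, with `Q(s,a;θ) = ⟨θ, φ(s,a)⟩`. -/
def semiGradient (θ : EuclideanSpace ℝ (Fin N)) (π : Policy S A) : EuclideanSpace ℝ (Fin N) :=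
  ∫ x, (⟪θ, φ x⟫ - m.bellman π (fun y => ⟪θ, φ y⟫) x) • φ x
    ∂occupancy m.γ (m.stateActionKernel π) β

/-- `Γ = (1 - γ) (1 - √γ) λ_β`. -/
def gammaConst : ℝ := (1 - m.γ) * (1 - √m.γ) * minEigenvalue φ β

/-- `Q(s,a;θ) + τ ln (dπ/dμ)(s,a)`. -/
def softQ (θ : EuclideanSpace ℝ (Fin N)) (π : Policy S A) (s : S) (a : A) : ℝ :=
  ⟪θ, φ (s, a)⟫ + m.τ * Real.log ((π.1 s).rnDeriv m.μ a).toReal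

/-- The approximate soft advantage function `A(s,a;θ,π)`. -/
def approxAdvantage (θ : EuclideanSpace ℝ (Fin N)) (π : Policy S A) (s : S) (a : A) : ℝ :=
  m.softQ φ θ π s a - ∫ a', m.softQ φ θ π s a' ∂π.1 s

/-- `∫ A(s,a;θ,π') π(da|s) + (1/lam) KL(π|π')(s)`, for `π, π' ∈ Π_μ` (the divergence is then
finite). -/
def actorIntegrand (lam : ℝ) (π π' : Policy S A) (θ : EuclideanSpace ℝ (Fin N)) (s : S) : ℝ :=
  ∫ a, m.approxAdvantage φ θ π' s a ∂π.1 s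
    + 1 / lam * (InformationTheory.klDiv (π.1 s) (π'.1 s)).toReal

/-- The actor objective `G̃(π,π',θ)`, the integral of `actorIntegrand` against `d^{π'}_ρ`. -/
def actorObjective (ρ : Measure S) (lam : ℝ) (π π' : Policy S A)
    (θ : EuclideanSpace ℝ (Fin N)) : ℝ :=
  ∫ s, m.actorIntegrand φ lam π π' θ s ∂occupancy m.γ (m.stateKernel π') ρ

/-- `(θⁿ, πⁿ)` are iterates of the double-loop actor-critic with critic step size `h`, actor step
size `lam` and `M n` inner temporal-difference steps in round `n`. The integrated objective sees
`πⁿ⁺¹(·|s)` only for almost every `s`, so `actor_pointwise` selects the version of the minimiser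
that minimises the integrand at every state. -/
structure IsDoubleLoop (ρ : Measure S) (h lam : ℝ) (M : ℕ → ℕ)
    (θ : ℕ → EuclideanSpace ℝ (Fin N)) (π : ℕ → Policy S A) : Prop where
  init : π 0 ∈ m.admissible
  critic : ∀ n, θ (n + 1) = (fun t => t - h • m.semiGradient φ β t (π n))^[M n] (θ n)
  actor_mem : ∀ n, π (n + 1) ∈ m.admissible
  actor_min : ∀ n, IsMinOn (fun p => m.actorObjective φ ρ lam p (π n) (θ (n + 1)))
    m.admissible (π (n + 1))
  actor_pointwise : ∀ n s, IsMinOn (fun p => m.actorIntegrand φ lam p (π n) (θ (n + 1)) s)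
    m.admissible (π (n + 1))

end EntropyMDP

end

/-! Write `α = τλ`. Every iterate is a Gibbs policy `πⁿ ∝ exp(-Gₙ/τ) μ`. By the Gibbs variational
identity the actor objective at each state is a constant plus a multiple of the divergence to
another Gibbs measure, so the pointwise minimiser is explicit: `Gₙ₊₁ = (1-α) Gₙ + α qₙ`, with `qₙ =
⟨θⁿ⁺¹, φ⟩` the critic. Since this holds at every state, everything can be measured in the sup norm.

The target is the fixed point `Q` of the soft Bellman optimality equation. Its free energy bounds
the value of every policy from below (`IsSoftOptimal.le_valueAt`), so it suffices to bound the
values of the iterates above it. Three quantities are coupled: `gₙ = sup |Gₙ - Q|`, `pₙ = sup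
(Q^{πⁿ} - Gₙ)⁺`, and the critic error `eₙ = ‖θⁿ⁺¹ - θ_{πⁿ}‖`. Approximate policy improvement gives
`pₙ₊₁ ≤ (1-α) pₙ + K eₙ`. The critic error is contracted by the inner loop, because `1 - γκ`, with
`κ` the state-action kernel, is coercive on `L²` of the occupancy measure and `λ_β > 0` turns this
into strong monotonicity in `θ`.

The crude estimate `Q^{πⁿ} - Q ≤ γ (pₙ + gₙ)` yields only the rate `1 - α(1-γ)`. This is still
enough for convergence to zero. Once `gₙ ≤ τ`, second-order expansion of the free energy gives
`Q^{πⁿ} - Q = O(gₙ²)` (`IsSoftOptimal.realValue_le_add_sq`), so asymptotically `g` also contracts at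
any rate above `1-α`. The step-size condition and `1 - 1/ξ < e^{-1/ξ}` give `1 - α < a =
e^{-min(1/ξ, c)}` strictly. That slack absorbs the quadratic term, and the growing number of inner
steps makes the critic error `O(aⁿ)`. -/

noncomputable section

/-! ### Bounded measurable functions, sup-norm contractions and a maximum principle. -/

/-- Bounded measurable real functions. -/
structure BddMeas {E : Type*} [MeasurableSpace E] (f : E → ℝ) : Prop where
  measurable : Measurable f
  bounded : ∃ C : ℝ, ∀ x, |f x| ≤ C

section Averages

variable {E : Type*} [MeasurableSpace E] {ν : Measure E} [IsProbabilityMeasure ν] {f g : E → ℝ}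

theorem integral_le_of_forall_le (hf : Integrable f ν) {C : ℝ} (h : ∀ x, f x ≤ C) :
    ∫ x, f x ∂ν ≤ C := by
  simpa using integral_mono hf (integrable_const C) h

theorem le_integral_of_forall_le (hf : Integrable f ν) {C : ℝ} (h : ∀ x, C ≤ f x) :
    C ≤ ∫ x, f x ∂ν := by
  simpa using integral_mono (integrable_const C) hf h

theorem abs_integral_le_of_forall_abs_le {C : ℝ} (h : ∀ x, |f x| ≤ C) : |∫ x, f x ∂ν| ≤ C := by
  simpa using norm_integral_le_of_norm_le_const (μ := ν) (f := f) (ae_of_all _ h)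

end Averages

namespace BddMeas

variable {E F : Type*} [MeasurableSpace E] [MeasurableSpace F] {f g : E → ℝ}

theorem exists_nonneg_bound (hf : BddMeas f) : ∃ C : ℝ, 0 ≤ C ∧ ∀ x, |f x| ≤ C := by
  obtain ⟨C, hC⟩ := hf.bounded
  exact ⟨max C 0, le_max_right _ _, fun x => (hC x).trans (le_max_left _ _)⟩

theorem integrable (hf : BddMeas f) (ν : Measure E) [IsFiniteMeasure ν] : Integrable f ν := by
  obtain ⟨C, hC⟩ := hf.bounded
  exact Integrable.of_bound hf.measurable.aestronglyMeasurable C (ae_of_all _ hC)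

theorem const (c : ℝ) : BddMeas fun _ : E => c := ⟨measurable_const, |c|, fun _ => le_rfl⟩

theorem add (hf : BddMeas f) (hg : BddMeas g) : BddMeas fun x => f x + g x := by
  obtain ⟨C, hC⟩ := hf.bounded
  obtain ⟨D, hD⟩ := hg.bounded
  exact ⟨hf.measurable.add hg.measurable, C + D,
    fun x => (abs_add_le _ _).trans (add_le_add (hC x) (hD x))⟩

theorem mul (hf : BddMeas f) (hg : BddMeas g) : BddMeas fun x => f x * g x := by
  obtain ⟨C, hC⟩ := hf.bounded
  obtain ⟨D, hD⟩ := hg.bounded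
  refine ⟨hf.measurable.mul hg.measurable, C * D, fun x => ?_⟩
  rw [abs_mul]
  exact mul_le_mul (hC x) (hD x) (abs_nonneg _) ((abs_nonneg _).trans (hC x))

theorem const_mul (c : ℝ) (hf : BddMeas f) : BddMeas fun x => c * f x := (const c).mul hf

theorem neg (hf : BddMeas f) : BddMeas fun x => -f x := by
  simpa using hf.const_mul (-1)

theorem sub (hf : BddMeas f) (hg : BddMeas g) : BddMeas fun x => f x - g x := by
  simpa [sub_eq_add_neg] using hf.add hg.neg

theorem div_const (hf : BddMeas f) (c : ℝ) : BddMeas fun x => f x / c := by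
  simpa [div_eq_mul_inv] using hf.mul (const c⁻¹)

theorem exp (hf : BddMeas f) : BddMeas fun x => Real.exp (f x) := by
  obtain ⟨C, hC⟩ := hf.bounded
  refine ⟨hf.measurable.exp, Real.exp C, fun x => ?_⟩
  rw [abs_of_pos (Real.exp_pos _)]
  exact Real.exp_le_exp.2 ((le_abs_self _).trans (hC x))

theorem comp (hf : BddMeas f) {k : F → E} (hk : Measurable k) : BddMeas fun x => f (k x) :=
  ⟨hf.measurable.comp hk, hf.bounded.imp fun _ h x => h (k x)⟩

theorem max_zero (hf : BddMeas f) : BddMeas fun x => max (f x) 0 := by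
  obtain ⟨C, h0, hC⟩ := hf.exists_nonneg_bound
  refine ⟨hf.measurable.max measurable_const, C, fun x => ?_⟩
  rw [abs_of_nonneg (le_max_right _ _)]
  exact max_le ((le_abs_self _).trans (hC x)) h0

theorem abs_le_iSup (hf : BddMeas f) (x : E) : |f x| ≤ ⨆ y, |f y| := by
  obtain ⟨C, hC⟩ := hf.bounded
  exact le_ciSup (f := fun y => |f y|) ⟨C, by rintro _ ⟨y, rfl⟩; exact hC y⟩ x

theorem fst (hf : BddMeas f) : BddMeas fun x : E × F => f x.1 := hf.comp measurable_fst

theorem section_right {f : E × F → ℝ} (hf : BddMeas f) (x : E) : BddMeas fun y => f (x, y) :=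
  hf.comp measurable_prodMk_left

theorem average {f : F → ℝ} (hf : BddMeas f) (κ : Kernel E F) [IsMarkovKernel κ] :
    BddMeas fun x => ∫ y, f y ∂κ x :=
  ⟨hf.measurable.stronglyMeasurable.integral_kernel.measurable,
    hf.bounded.imp fun _ h _ => abs_integral_le_of_forall_abs_le h⟩

theorem average_section {f : E × F → ℝ} (hf : BddMeas f) (κ : Kernel E F) [IsMarkovKernel κ] :
    BddMeas fun x => ∫ y, f (x, y) ∂κ x :=
  ⟨(StronglyMeasurable.integral_kernel_prod_right' (κ := κ)
      hf.measurable.stronglyMeasurable).measurable,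
    hf.bounded.imp fun _ h x => abs_integral_le_of_forall_abs_le fun y => h (x, y)⟩

/-- A sup-norm contraction of the bounded measurable functions has a fixed point. -/
theorem exists_fixedPoint (T : (E → ℝ) → E → ℝ) (hT : ∀ f, BddMeas f → BddMeas (T f))
    {γ : ℝ} (hγ0 : 0 ≤ γ) (hγ : γ < 1)
    (hc : ∀ f g, BddMeas f → BddMeas g → ∀ C, (∀ x, |f x - g x| ≤ C) →
      ∀ x, |T f x - T g x| ≤ γ * C) :
    ∃ f, BddMeas f ∧ ∀ x, T f x = f x := by
  have hu : ∀ n, BddMeas (T^[n] 0) := fun n => by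
    induction n with
    | zero => exact const 0
    | succ n ih => rw [Function.iterate_succ_apply']; exact hT _ ih
  obtain ⟨C, hC⟩ := (hT _ (hu 0)).bounded
  have hstep : ∀ n x, dist (T^[n] 0 x) (T^[n + 1] 0 x) ≤ C * γ ^ n := fun n => by
    induction n with
    | zero => intro x; simpa [Real.dist_eq] using hC x
    | succ n ih =>
      intro x
      have := hc _ _ (hu n) (hu (n + 1)) (C * γ ^ n) ih x
      rw [← Function.iterate_succ_apply' T, ← Function.iterate_succ_apply' T] at this
      rw [Real.dist_eq, pow_succ]
      linarith
  -- Limits are taken pointwise; the geometric bound is uniform in `x`, which keeps the limit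
  -- bounded and lets `T` pass to it.
  have hlim : ∀ x, ∃ l, Filter.Tendsto (fun n => T^[n] 0 x) Filter.atTop (nhds l) := fun x =>
    cauchySeq_tendsto_of_complete (cauchySeq_of_le_geometric γ C hγ fun n => hstep n x)
  choose f hf using hlim
  have hdist : ∀ n x, |T^[n] 0 x - f x| ≤ C * γ ^ n / (1 - γ) := fun n x =>
    dist_le_of_le_geometric_of_tendsto γ C hγ (fun n => hstep n x) (hf x) n
  have hfm : BddMeas f := by
    refine ⟨measurable_of_tendsto_metrizable (fun n => (hu n).measurable)
      (tendsto_pi_nhds.2 hf), C * γ ^ 0 / (1 - γ), fun x => ?_⟩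
    simpa using hdist 0 x
  refine ⟨f, hfm, fun x => ?_⟩
  have h0 : Filter.Tendsto (fun n : ℕ => C * γ ^ (n + 1) / (1 - γ)) Filter.atTop (nhds 0) := by
    have := ((tendsto_pow_atTop_nhds_zero_of_lt_one hγ0 hγ).comp
      (Filter.tendsto_add_atTop_nat 1)).const_mul C |>.div_const (1 - γ)
    simpa using this
  have h1 : Filter.Tendsto (fun n => T^[n + 1] 0 x) Filter.atTop (nhds (T f x)) := by
    rw [tendsto_iff_dist_tendsto_zero]
    refine squeeze_zero (fun _ => dist_nonneg) (fun n => ?_) h0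
    rw [Function.iterate_succ_apply', Real.dist_eq]
    refine (hc _ _ (hu n) hfm _ (hdist n) x).trans (le_of_eq ?_)
    ring
  exact tendsto_nhds_unique h1 ((Filter.tendsto_add_atTop_iff_nat 1).2 (hf x))

end BddMeas

/-- A function with `sup u ≤ b + γ sup u` satisfies `u ≤ b / (1 - γ)`. -/
theorem le_div_of_forall_upper_bound {E : Type*} {u : E → ℝ} {b γ : ℝ} (hγ : γ < 1)
    (hu : ∃ C, ∀ x, u x ≤ C) (h : ∀ B, (∀ x, u x ≤ B) → ∀ x, u x ≤ b + γ * B) (x : E) :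
    u x ≤ b / (1 - γ) := by
  have : Nonempty E := ⟨x⟩
  have hb : BddAbove (Set.range u) := by
    obtain ⟨C, hC⟩ := hu
    exact ⟨C, by rintro _ ⟨y, rfl⟩; exact hC y⟩
  have h1 : ⨆ y, u y ≤ b + γ * ⨆ y, u y := ciSup_le (h _ (le_ciSup hb))
  refine (le_ciSup hb x).trans ?_
  rw [le_div_iff₀ (by linarith)]
  linarith

/-! ### Free energy and Gibbs measures. -/

/-- The free energy `-τ log ∫ exp(-f/τ) dμ`, the minimum of `p ↦ ∫ f dp + τ KL(p|μ)`. -/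
def freeEnergy {A : Type*} [MeasurableSpace A] (μ : Measure A) (τ : ℝ) (f : A → ℝ) : ℝ :=
  -τ * Real.log (∫ a, Real.exp (-f a / τ) ∂μ)

/-- The Gibbs measure proportional to `exp(-f/τ) dμ`. -/
def gibbs {A : Type*} [MeasurableSpace A] (μ : Measure A) (τ : ℝ) (f : A → ℝ) : Measure A :=
  μ.tilted fun a => -f a / τ

theorem gibbs_absolutelyContinuous {A : Type*} [MeasurableSpace A] {μ : Measure A} {τ : ℝ}
    {f : A → ℝ} : gibbs μ τ f ≪ μ := tilted_absolutelyContinuous _ _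

section Gibbs

open InformationTheory

variable {A : Type*} [MeasurableSpace A] {μ : Measure A} [IsProbabilityMeasure μ] {τ : ℝ}
  {f g : A → ℝ}

theorem BddMeas.integrable_exp_neg_div (hf : BddMeas f) (τ : ℝ) (ν : Measure A)
    [IsFiniteMeasure ν] : Integrable (fun a => Real.exp (-f a / τ)) ν :=
  (hf.neg.div_const τ).exp.integrable ν

theorem isProbabilityMeasure_gibbs (hf : BddMeas f) : IsProbabilityMeasure (gibbs μ τ f) :=
  isProbabilityMeasure_tilted (hf.integrable_exp_neg_div τ μ)

theorem absolutelyContinuous_gibbs (hf : BddMeas f) : μ ≪ gibbs μ τ f :=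
  absolutelyContinuous_tilted (hf.integrable_exp_neg_div τ μ)

/-- Recovers the potential from the policy up to a constant in the action; that constant cancels in
the advantage. -/
theorem log_rnDeriv_gibbs (hτ : τ ≠ 0) (hf : BddMeas f) :
    (fun a => τ * Real.log ((gibbs μ τ f).rnDeriv μ a).toReal) =ᵐ[μ]
      fun a => freeEnergy μ τ f - f a := by
  filter_upwards [log_rnDeriv_tilted_left_self (hf.integrable_exp_neg_div τ μ)] with a ha
  rw [gibbs, ha, freeEnergy]
  field_simp
  ring

theorem llr_gibbs (hτ : τ ≠ 0) (hf : BddMeas f) :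
    llr (gibbs μ τ f) μ =ᵐ[gibbs μ τ f] fun a => (freeEnergy μ τ f - f a) / τ := by
  filter_upwards [gibbs_absolutelyContinuous.ae_le (log_rnDeriv_gibbs (μ := μ) hτ hf)] with a ha
  rw [llr, ← ha]
  field_simp

theorem klDiv_gibbs_ne_top (hτ : τ ≠ 0) (hf : BddMeas f) : klDiv (gibbs μ τ f) μ ≠ ⊤ := by
  have := isProbabilityMeasure_gibbs (μ := μ) (τ := τ) hf
  refine klDiv_ne_top gibbs_absolutelyContinuous ?_
  rw [integrable_congr (llr_gibbs hτ hf)]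
  exact (((BddMeas.const _).sub hf).div_const τ).integrable _

/-- The Gibbs variational identity. -/
theorem integral_add_mul_klDiv (hτ : τ ≠ 0) (hf : BddMeas f) {p : Measure A}
    [IsProbabilityMeasure p] (hp : klDiv p μ ≠ ⊤) :
    ∫ a, f a ∂p + τ * (klDiv p μ).toReal
      = freeEnergy μ τ f + τ * (klDiv p (gibbs μ τ f)).toReal := by
  have := isProbabilityMeasure_gibbs (μ := μ) (τ := τ) hf
  obtain ⟨hac, hint⟩ := klDiv_ne_top_iff.1 hp
  rw [toReal_klDiv_of_measure_eq (hac.trans (absolutelyContinuous_gibbs hf)) (by simp),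
    toReal_klDiv_of_measure_eq hac (by simp), gibbs,
    integral_llr_tilted_right hac ((hf.neg.div_const τ).integrable p)
      (hf.integrable_exp_neg_div τ μ) hint, integral_div, integral_neg, freeEnergy]
  field_simp
  ring

theorem klDiv_gibbs_right_ne_top (hf : BddMeas f) {p : Measure A}
    [IsProbabilityMeasure p] (hp : klDiv p μ ≠ ⊤) : klDiv p (gibbs μ τ f) ≠ ⊤ := by
  obtain ⟨hac, hint⟩ := klDiv_ne_top_iff.1 hp
  exact klDiv_ne_top (hac.trans (absolutelyContinuous_gibbs hf))
    (integrable_llr_tilted_right hac ((hf.neg.div_const τ).integrable p) hint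
      (hf.integrable_exp_neg_div τ μ))

theorem freeEnergy_le (hτ : 0 < τ) (hf : BddMeas f) {p : Measure A}
    [IsProbabilityMeasure p] (hp : klDiv p μ ≠ ⊤) :
    freeEnergy μ τ f ≤ ∫ a, f a ∂p + τ * (klDiv p μ).toReal := by
  rw [integral_add_mul_klDiv hτ.ne' hf hp]
  have := mul_nonneg hτ.le (ENNReal.toReal_nonneg (a := klDiv p (gibbs μ τ f)))
  linarith

/-- The variational inequality in `[0,∞]`, needed for arbitrary policies, whose divergence may be
infinite. -/
theorem ofReal_freeEnergy_sub_le (hτ : 0 < τ) (hf : BddMeas f) (p : Measure A)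
    [IsProbabilityMeasure p] :
    ENNReal.ofReal (freeEnergy μ τ f - ∫ a, f a ∂p) ≤ ENNReal.ofReal τ * klDiv p μ := by
  by_cases hp : klDiv p μ = ⊤
  · simp [hp, ENNReal.mul_top, hτ]
  · rw [← ENNReal.ofReal_toReal hp, ← ENNReal.ofReal_mul hτ.le]
    exact ENNReal.ofReal_le_ofReal (by linarith [freeEnergy_le hτ hf hp])

theorem integral_add_mul_klDiv_gibbs (hτ : τ ≠ 0) (hf : BddMeas f) :
    ∫ a, f a ∂gibbs μ τ f + τ * (klDiv (gibbs μ τ f) μ).toReal = freeEnergy μ τ f := by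
  have := isProbabilityMeasure_gibbs (μ := μ) (τ := τ) hf
  rw [integral_add_mul_klDiv hτ hf (klDiv_gibbs_ne_top hτ hf), klDiv_self]
  simp

/-- Test the minimisation defining the free energy of `f` with the Gibbs measure of `g`. The
two-sided version below makes the soft Bellman operator a `γ`-contraction. -/
theorem freeEnergy_le_freeEnergy_add (hτ : 0 < τ) (hf : BddMeas f) (hg : BddMeas g) {d : ℝ}
    (h : ∀ a, f a ≤ g a + d) : freeEnergy μ τ f ≤ freeEnergy μ τ g + d := by
  have := isProbabilityMeasure_gibbs (μ := μ) (τ := τ) hg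
  have h1 := freeEnergy_le hτ hf (klDiv_gibbs_ne_top (μ := μ) hτ.ne' hg)
  have h2 := integral_add_mul_klDiv_gibbs (μ := μ) hτ.ne' hg
  have h3 := integral_mono (hf.integrable (gibbs μ τ g))
    ((hg.add (BddMeas.const d)).integrable (gibbs μ τ g)) h
  rw [integral_add (hg.integrable _) (integrable_const d)] at h3
  simp at h3
  linarith

theorem abs_freeEnergy_sub_le (hτ : 0 < τ) (hf : BddMeas f) (hg : BddMeas g) {d : ℝ}
    (h : ∀ a, |f a - g a| ≤ d) : |freeEnergy μ τ f - freeEnergy μ τ g| ≤ d := by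
  have h1 := freeEnergy_le_freeEnergy_add (μ := μ) hτ hf hg (d := d)
    fun a => by linarith [(abs_le.1 (h a)).2]
  have h2 := freeEnergy_le_freeEnergy_add (μ := μ) hτ hg hf (d := d)
    fun a => by linarith [(abs_le.1 (h a)).1]
  rw [abs_le]
  constructor <;> linarith

/-- The excess of the regularised cost of the Gibbs measure of `g` over its minimum for the
potential `f` is quadratic in `f - g`. -/
theorem integral_add_mul_klDiv_gibbs_le (hτ : 0 < τ) (hf : BddMeas f) (hg : BddMeas g) {d : ℝ}
    (h : ∀ a, |f a - g a| ≤ d) (hd : d ≤ τ) :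
    ∫ a, f a ∂gibbs μ τ g + τ * (klDiv (gibbs μ τ g) μ).toReal
      ≤ freeEnergy μ τ f + d ^ 2 / τ := by
  have hp := isProbabilityMeasure_gibbs (μ := μ) (τ := τ) hg
  set p := gibbs μ τ g with hpdef
  -- The free energies differ by `-τ log ∫ exp X dp`. Since `|X| ≤ d/τ ≤ 1`, `exp X ≤ 1 + X + X²`;
  -- the linear term cancels against `∫ f dp - ∫ g dp`, leaving only the square.
  set X : A → ℝ := fun a => (g a - f a) / τ with hX
  have hXb : BddMeas X := (hg.sub hf).div_const τ
  have hXd : ∀ a, |X a| ≤ d / τ := fun a => by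
    rw [hX]; simp only
    rw [abs_div, abs_of_pos hτ, abs_sub_comm]
    exact div_le_div_of_nonneg_right (h a) hτ.le
  have hd1 : d / τ ≤ 1 := (div_le_one hτ).2 hd
  have hpart : ∫ a, Real.exp (-f a / τ) ∂μ
      = (∫ a, Real.exp (-g a / τ) ∂μ) * ∫ a, Real.exp (X a) ∂p := by
    rw [hpdef, gibbs, integral_exp_tilted, mul_div_cancel₀]
    · refine integral_congr_ae (ae_of_all _ fun a => ?_)
      simp only [hX, Pi.add_apply]
      congr 1
      ring
    · exact (integral_exp_pos (hg.integrable_exp_neg_div τ μ)).ne'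
  have hlog : freeEnergy μ τ f = freeEnergy μ τ g - τ * Real.log (∫ a, Real.exp (X a) ∂p) := by
    rw [freeEnergy, hpart, Real.log_mul (integral_exp_pos (hg.integrable_exp_neg_div τ μ)).ne'
      (integral_exp_pos (hXb.exp.integrable p)).ne', freeEnergy]
    ring
  have hexp : ∫ a, Real.exp (X a) ∂p ≤ 1 + ∫ a, X a ∂p + (d / τ) ^ 2 := by
    have h1 : ∀ a, Real.exp (X a) ≤ X a + (1 + (d / τ) ^ 2) := fun a => by
      have h2 := (abs_le.1 (Real.abs_exp_sub_one_sub_id_le ((hXd a).trans hd1))).2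
      have h3 : X a ^ 2 ≤ (d / τ) ^ 2 := sq_le_sq' (abs_le.1 (hXd a)).1 (abs_le.1 (hXd a)).2
      linarith
    have h4 := integral_mono (hXb.exp.integrable p)
      ((hXb.add (BddMeas.const _)).integrable p) h1
    rw [integral_add (hXb.integrable _) (integrable_const _)] at h4
    simp at h4
    linarith
  have hle : Real.log (∫ a, Real.exp (X a) ∂p) ≤ ∫ a, X a ∂p + (d / τ) ^ 2 := by
    have := Real.log_le_sub_one_of_pos (integral_exp_pos (hXb.exp.integrable p))
    linarith
  have hXint : τ * ∫ a, X a ∂p = ∫ a, g a ∂p - ∫ a, f a ∂p := by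
    rw [hX, integral_div, integral_sub (hg.integrable p) (hf.integrable p)]
    field_simp
  have h5 := integral_add_mul_klDiv_gibbs (μ := μ) hτ.ne' hg
  rw [← hpdef] at h5
  have h6 := mul_le_mul_of_nonneg_left hle hτ.le
  have h7 : τ * (d / τ) ^ 2 = d ^ 2 / τ := by field_simp
  rw [mul_add, h7, hXint] at h6
  linarith

theorem BddMeas.freeEnergy_section {S : Type*} [MeasurableSpace S] {f : S × A → ℝ}
    (hf : BddMeas f) (hτ : 0 < τ) : BddMeas fun s => freeEnergy μ τ fun a => f (s, a) := by
  obtain ⟨C, hC⟩ := hf.bounded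
  refine ⟨?_, C, fun s => ?_⟩
  · refine measurable_const.mul (Measurable.log ?_)
    exact (StronglyMeasurable.integral_prod_right' (ν := μ)
      (hf.neg.div_const τ).exp.measurable.stronglyMeasurable).measurable
  · have h0 : freeEnergy μ τ (fun _ => (0 : ℝ)) = 0 := by simp [freeEnergy]
    have := abs_freeEnergy_sub_le (μ := μ) hτ (hf.section_right s) (BddMeas.const 0)
      (d := C) fun a => by simpa using hC (s, a)
    rwa [h0, sub_zero] at this

end Gibbs

/-! ### Markov chain laws and discounted sums. -/

theorem bind_comap {E F G : Type*} [MeasurableSpace E] [MeasurableSpace F] [MeasurableSpace G]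
    (ν : Measure E) (κ : Kernel F G) {f : E → F} (hf : Measurable f) :
    ν.bind (κ.comap f hf) = (ν.map f).bind κ := by
  ext s hs
  rw [Measure.bind_apply hs (Kernel.aemeasurable _), Measure.bind_apply hs (Kernel.aemeasurable _),
    lintegral_map (κ.measurable_coe hs) hf]
  rfl

section Chain

variable {E : Type*} [MeasurableSpace E] (κ : Kernel E E) [IsMarkovKernel κ] (ν : Measure E)

/-- The law of the Markov chain with initial law `ν` and transition kernel `κ`. -/
def chainLaw : Measure (ℕ → E) :=
  Kernel.trajMeasure (X := fun _ => E) ν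
    fun n => κ.comap (fun x : (i : Finset.Iic n) → E => x ⟨n, Finset.mem_Iic.2 le_rfl⟩)
      (measurable_pi_apply _)

instance [IsProbabilityMeasure ν] : IsProbabilityMeasure (chainLaw κ ν) := by
  unfold chainLaw; infer_instance

theorem chainLaw_map_zero : (chainLaw κ ν).map (fun ω => ω 0) = ν := by
  have h : (fun ω : ℕ → E => ω 0) =
      (fun x : (i : Finset.Iic 0) → E => x ⟨0, Finset.mem_Iic.2 le_rfl⟩) ∘
        Preorder.frestrictLe (π := fun _ => E) 0 := rfl
  rw [h, ← Measure.map_map (measurable_pi_apply _) (by fun_prop), chainLaw, Kernel.trajMeasure,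
    Measure.map_comp _ _ (by fun_prop), Kernel.traj_map_frestrictLe, Kernel.partialTraj_self,
    Measure.id_comp, Measure.map_map (measurable_pi_apply _) (by fun_prop)]
  exact Measure.map_id

/-- The trajectory kernel reads only the last coordinate of the history, so projecting the joint law
of history and next state gives the Markov recursion for the marginals. -/
theorem chainLaw_map_succ [IsProbabilityMeasure ν] (n : ℕ) :
    (chainLaw κ ν).map (fun ω => ω (n + 1)) = ((chainLaw κ ν).map fun ω => ω n).bind κ := by
  have h := Kernel.map_frestrictLe_trajMeasure_compProd_eq_map_trajMeasure
    (X := fun _ => E) (μ₀ := ν)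
    (κ := fun n => κ.comap (fun x : (i : Finset.Iic n) → E => x ⟨n, Finset.mem_Iic.2 le_rfl⟩)
      (measurable_pi_apply _)) (a := n)
  have h2 := congrArg Measure.snd h
  rw [Measure.snd_compProd, Measure.snd, Measure.map_map measurable_snd (by fun_prop),
    bind_comap, Measure.map_map (measurable_pi_apply _) (by fun_prop)] at h2
  exact h2.symm

end Chain

theorem integral_bind_kernel {E F : Type*} [MeasurableSpace E] [MeasurableSpace F]
    (ν : Measure E) [IsFiniteMeasure ν] (κ : Kernel E F) [IsMarkovKernel κ] {f : F → ℝ}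
    (hf : BddMeas f) : ∫ y, f y ∂ν.bind κ = ∫ x, ∫ y, f y ∂κ x ∂ν :=
  Kernel.integral_comp (κ := Kernel.const Unit ν) (η := κ) (a := ()) (hf.integrable _)

section Discounted

variable {E : Type*} [MeasurableSpace E] {κ : Kernel E E} [IsMarkovKernel κ] {γ : ℝ}

/-- The solution of the linear Bellman equation `u = r + γ κ u`. -/
theorem BddMeas.exists_eq_add_mul_average {r : E → ℝ} (hr : BddMeas r) (κ : Kernel E E)
    [IsMarkovKernel κ] (h0 : 0 ≤ γ) (h1 : γ < 1) :
    ∃ u, BddMeas u ∧ ∀ x, u x = r x + γ * ∫ y, u y ∂κ x := by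
  obtain ⟨u, hu, h⟩ := BddMeas.exists_fixedPoint (fun u x => r x + γ * ∫ y, u y ∂κ x)
    (fun f hf => hr.add ((hf.average κ).const_mul γ)) h0 h1 fun f g hf hg C hC x => by
      rw [add_sub_add_left_eq_sub, ← mul_sub, ← integral_sub (hf.integrable _) (hg.integrable _),
        abs_mul, abs_of_nonneg h0]
      exact mul_le_mul_of_nonneg_left (abs_integral_le_of_forall_abs_le hC) h0
  exact ⟨u, hu, fun x => (h x).symm⟩

/-- Maximum principle applied to `-u`. -/
theorem nonneg_of_eq_add_mul_average {r u : E → ℝ} (h0 : 0 ≤ γ) (h1 : γ < 1) (hu : BddMeas u)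
    (hr0 : ∀ x, 0 ≤ r x) (h : ∀ x, u x = r x + γ * ∫ y, u y ∂κ x) (x : E) : 0 ≤ u x := by
  have h2 := le_div_of_forall_upper_bound (u := fun x => -u x) (b := 0) h1
    (hu.neg.bounded.imp fun C h x => (le_abs_self _).trans (h x)) (fun B hB x => by
      have h3 := le_integral_of_forall_le (hu.integrable (κ x)) (fun y => neg_le.1 (hB y))
      have h4 := mul_le_mul_of_nonneg_left h3 h0
      rw [h x]
      linarith [hr0 x]) x
  simpa using h2

variable {ν : Measure E} [IsProbabilityMeasure ν] {r u : E → ℝ}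

theorem summable_discounted (h0 : 0 ≤ γ) (h1 : γ < 1) {a : ℕ → ℝ} {C : ℝ} (h : ∀ n, |a n| ≤ C) :
    Summable fun n => γ ^ n * a n := by
  refine Summable.of_norm_bounded ((summable_geometric_of_lt_one h0 h1).mul_right C) fun n => ?_
  rw [norm_mul, Real.norm_eq_abs, Real.norm_eq_abs, abs_of_nonneg (pow_nonneg h0 n)]
  exact mul_le_mul_of_nonneg_left (h n) (pow_nonneg h0 n)

theorem integral_chainLaw_eq (hu : BddMeas u) (n : ℕ) :
    ∫ ω, u (ω (n + 1)) ∂chainLaw κ ν = ∫ ω, ∫ y, u y ∂κ (ω n) ∂chainLaw κ ν := by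
  have h := integral_map (μ := chainLaw κ ν) (φ := fun ω => ω (n + 1)) (f := u)
    (measurable_pi_apply _).aemeasurable hu.measurable.aestronglyMeasurable
  have : IsProbabilityMeasure ((chainLaw κ ν).map fun ω => ω n) :=
    Measure.isProbabilityMeasure_map (measurable_pi_apply _).aemeasurable
  rw [← h, chainLaw_map_succ, integral_bind_kernel _ _ hu,
    integral_map (measurable_pi_apply _).aemeasurable (hu.average κ).measurable.aestronglyMeasurable]

/-- With `aₙ = γⁿ 𝔼 u(ωₙ)`, the linear Bellman equation turns the expected `n`-th reward into `aₙ -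
aₙ₊₁`. The sum telescopes to `a₀`, and `aₙ → 0` by boundedness. -/
theorem integral_tsum_discounted (h0 : 0 ≤ γ) (h1 : γ < 1) (hr : BddMeas r) (hu : BddMeas u)
    (h : ∀ x, u x = r x + γ * ∫ y, u y ∂κ x) :
    ∫ ω, ∑' n : ℕ, γ ^ n * r (ω n) ∂chainLaw κ ν = ∫ x, u x ∂ν := by
  obtain ⟨C, hC⟩ := hr.bounded
  obtain ⟨D, hD⟩ := hu.bounded
  have hb : ∀ {f : E → ℝ}, BddMeas f → ∀ n, BddMeas fun ω : ℕ → E => f (ω n) := fun hf n =>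
    hf.comp (measurable_pi_apply n)
  have hsum : ∫ ω, ∑' n : ℕ, γ ^ n * r (ω n) ∂chainLaw κ ν
      = ∑' n : ℕ, ∫ ω, γ ^ n * r (ω n) ∂chainLaw κ ν := by
    refine (integral_tsum_of_summable_integral_norm
      (fun n => ((hb hr n).const_mul _).integrable _) ?_).symm
    simp_rw [norm_mul, Real.norm_eq_abs, abs_of_nonneg (pow_nonneg h0 _), integral_const_mul]
    exact summable_discounted h0 h1 fun n =>
      abs_integral_le_of_forall_abs_le (C := C) fun ω => by rw [abs_abs]; exact hC _
  set a : ℕ → ℝ := fun n => γ ^ n * ∫ ω, u (ω n) ∂chainLaw κ ν with ha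
  have hterm : ∀ n, ∫ ω, γ ^ n * r (ω n) ∂chainLaw κ ν = a n - a (n + 1) := fun n => by
    have h2 : ∀ ω : ℕ → E, r (ω n) = u (ω n) - γ * ∫ y, u y ∂κ (ω n) := fun ω => by
      rw [h (ω n)]; ring
    simp_rw [integral_const_mul, h2]
    rw [integral_sub ((hb hu n).integrable _) (((hb (hu.average κ) n).const_mul γ).integrable _),
      integral_const_mul, ha]
    simp only
    rw [integral_chainLaw_eq hu]
    ring
  have hlim : Filter.Tendsto a Filter.atTop (nhds 0) :=
    (summable_discounted h0 h1 (a := fun n => ∫ ω, u (ω n) ∂chainLaw κ ν) fun n =>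
      abs_integral_le_of_forall_abs_le (C := D) fun ω => hD (ω n)).tendsto_atTop_zero
  rw [hsum]
  simp_rw [hterm]
  have hs : Summable fun n => a n - a (n + 1) := by
    simp_rw [← hterm, integral_const_mul]
    exact summable_discounted h0 h1 fun n =>
      abs_integral_le_of_forall_abs_le (C := C) fun ω => hC (ω n)
  refine (hs.hasSum_iff_tendsto_nat.2 ?_).tsum_eq
  simp_rw [Finset.sum_range_sub']
  have h3 : a 0 = ∫ x, u x ∂ν := by
    rw [ha]
    simp only [pow_zero, one_mul]
    conv_rhs => rw [← chainLaw_map_zero κ ν]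
    rw [integral_map (measurable_pi_apply _).aemeasurable hu.measurable.aestronglyMeasurable]
  simpa [h3] using hlim.const_sub (a 0)

theorem lintegral_tsum_discounted (h0 : 0 ≤ γ) (h1 : γ < 1) (hr : BddMeas r) (hu : BddMeas u)
    (hr0 : ∀ x, 0 ≤ r x) (h : ∀ x, u x = r x + γ * ∫ y, u y ∂κ x) :
    ∫⁻ ω, ∑' n : ℕ, ENNReal.ofReal (γ ^ n * r (ω n)) ∂chainLaw κ ν
      = ENNReal.ofReal (∫ x, u x ∂ν) := by
  obtain ⟨C, hC⟩ := hr.bounded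
  rw [← integral_tsum_discounted h0 h1 hr hu h, ofReal_integral_eq_lintegral_ofReal]
  · refine lintegral_congr fun ω => (ENNReal.ofReal_tsum_of_nonneg
      (fun n => mul_nonneg (pow_nonneg h0 n) (hr0 _))
      (summable_discounted h0 h1 (a := fun n => r (ω n)) fun n => hC (ω n))).symm
  · refine BddMeas.integrable ⟨?_, ∑' n : ℕ, γ ^ n * C, fun ω => ?_⟩ _
    · exact Measurable.tsum fun n =>
        measurable_const.mul (hr.measurable.comp (measurable_pi_apply n))
    · rw [abs_of_nonneg (tsum_nonneg fun n => mul_nonneg (pow_nonneg h0 n) (hr0 _))]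
      refine (summable_discounted h0 h1 (a := fun n => r (ω n)) fun n => hC (ω n)).tsum_le_tsum (fun n => ?_)
        ((summable_geometric_of_lt_one h0 h1).mul_right C)
      exact mul_le_mul_of_nonneg_left ((le_abs_self _).trans (hC _)) (pow_nonneg h0 n)
  · exact ae_of_all _ fun ω => tsum_nonneg fun n => mul_nonneg (pow_nonneg h0 n) (hr0 _)

end Discounted

/-! ### Value functions and the soft Bellman optimality equation. -/

namespace EntropyMDP

variable {S A : Type*} [MeasurableSpace S] [MeasurableSpace A] (m : EntropyMDP S A)
  {π : Policy S A}

theorem isProbabilityMeasure_initial (π : Policy S A) (s : S) :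
    IsProbabilityMeasure ((π.1 s).map fun a => (s, a)) :=
  Measure.isProbabilityMeasure_map (by fun_prop)

theorem integral_initial {f : S × A → ℝ} (hf : BddMeas f) (π : Policy S A) (s : S) :
    ∫ x, f x ∂(π.1 s).map (fun a => (s, a)) = ∫ a, f (s, a) ∂π.1 s :=
  integral_map (by fun_prop) hf.measurable.aestronglyMeasurable

theorem integral_stateActionKernel {f : S × A → ℝ} (hf : BddMeas f) (π : Policy S A)
    (x : S × A) :
    ∫ y, f y ∂m.stateActionKernel π x = ∫ s', ∫ a', f (s', a') ∂π.1 s' ∂m.P x := by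
  have : IsFiniteMeasure ((m.P ⊗ₖ Kernel.prodMkLeft (S × A) π.1) x) := inferInstance
  rw [stateActionKernel, integral_compProd (hf.integrable _)]
  rfl

theorem bddMeas_cost : BddMeas m.cost := ⟨m.cost_measurable, m.cost_bounded⟩

theorem costValue_eq {u : S × A → ℝ} (hu : BddMeas u)
    (h : ∀ x, u x = m.cost x + m.γ * ∫ y, u y ∂m.stateActionKernel π x) (s : S) :
    m.costValue π s = ∫ a, u (s, a) ∂π.1 s := by
  have := isProbabilityMeasure_initial π s
  rw [← integral_initial hu]
  -- `pathLaw` unfolds to `chainLaw` started from the law of `(s, a)` with `a ∼ π(·|s)`.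
  exact integral_tsum_discounted m.γ_pos.le m.γ_lt_one m.bddMeas_cost hu h

/-- The entropy part of the value dominates the discounted sum of any bounded function that is
dominated by the divergence. -/
theorem ofReal_le_entropyValue {u : S × A → ℝ} {r : S → ℝ} (hu : BddMeas u) (hr : BddMeas r)
    (hr0 : ∀ s, 0 ≤ r s) (hle : ∀ s, ENNReal.ofReal (r s) ≤ ENNReal.ofReal m.τ * m.kl π s)
    (h : ∀ x, u x = r x.1 + m.γ * ∫ y, u y ∂m.stateActionKernel π x) (s : S) :
    ENNReal.ofReal (∫ a, u (s, a) ∂π.1 s) ≤ m.entropyValue π s := by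
  have := isProbabilityMeasure_initial π s
  rw [← integral_initial hu, ← lintegral_tsum_discounted m.γ_pos.le m.γ_lt_one hr.fst hu
    (fun x => hr0 _) h]
  refine lintegral_mono fun ω => ENNReal.tsum_le_tsum fun n => ?_
  rw [ENNReal.ofReal_mul (pow_nonneg m.γ_pos.le n), ENNReal.ofReal_mul (pow_nonneg m.γ_pos.le n),
    mul_assoc]
  gcongr
  exact hle _

theorem entropyValue_eq {u : S × A → ℝ} {k : S → ℝ} (hu : BddMeas u) (hk : BddMeas k)
    (hk0 : ∀ s, 0 ≤ k s) (hkl : ∀ s, m.kl π s = ENNReal.ofReal (k s))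
    (h : ∀ x, u x = m.τ * k x.1 + m.γ * ∫ y, u y ∂m.stateActionKernel π x) (s : S) :
    m.entropyValue π s = ENNReal.ofReal (∫ a, u (s, a) ∂π.1 s) := by
  have := isProbabilityMeasure_initial π s
  rw [← integral_initial hu, ← lintegral_tsum_discounted (r := fun x : S × A => m.τ * k x.1)
    m.γ_pos.le m.γ_lt_one (hk.fst.const_mul m.τ) hu (fun x => mul_nonneg m.τ_pos.le (hk0 _)) h]
  refine lintegral_congr fun ω => tsum_congr fun n => ?_
  rw [hkl, ← ENNReal.ofReal_mul (mul_nonneg (pow_nonneg m.γ_pos.le n) m.τ_pos.le), mul_assoc]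

/-- `π` is the Gibbs policy `π(da|s) ∝ exp(-G(s,a)/τ) μ(da)`. -/
def IsGibbs (π : Policy S A) (G : S × A → ℝ) : Prop :=
  BddMeas G ∧ ∀ s, π.1 s = gibbs m.μ m.τ fun a => G (s, a)

variable {m}

theorem exists_isGibbs (hπ : π ∈ m.admissible) : ∃ G, m.IsGibbs π G := by
  obtain ⟨f, hf, hb, h⟩ := hπ
  refine ⟨fun x => -m.τ * f x, (BddMeas.mk hf hb).const_mul _, fun s => ?_⟩
  rw [h s, gibbs]
  congr 1
  ext a
  have := m.τ_pos.ne'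
  field_simp

namespace IsGibbs

variable {G : S × A → ℝ}

theorem mem_admissible (h : m.IsGibbs π G) : π ∈ m.admissible :=
  ⟨fun x => -G x / m.τ, (h.1.neg.div_const _).measurable, (h.1.neg.div_const _).bounded, h.2⟩

theorem kl_ne_top (h : m.IsGibbs π G) (s : S) : m.kl π s ≠ ⊤ := by
  rw [kl, h.2 s]
  exact klDiv_gibbs_ne_top m.τ_pos.ne' (h.1.section_right s)

theorem integral_add_mul_kl (h : m.IsGibbs π G) (s : S) :
    ∫ a, G (s, a) ∂π.1 s + m.τ * (m.kl π s).toReal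
      = freeEnergy m.μ m.τ fun a => G (s, a) := by
  rw [kl, h.2 s]
  exact integral_add_mul_klDiv_gibbs m.τ_pos.ne' (h.1.section_right s)

theorem bddMeas_kl (h : m.IsGibbs π G) : BddMeas fun s => (m.kl π s).toReal := by
  have h1 : (fun s => (m.kl π s).toReal) = fun s =>
      ((freeEnergy m.μ m.τ fun a => G (s, a)) - ∫ a, G (s, a) ∂π.1 s) / m.τ := by
    ext s
    rw [← h.integral_add_mul_kl s]
    have := m.τ_pos.ne'
    field_simp
    ring
  rw [h1]
  exact ((h.1.freeEnergy_section m.τ_pos).sub (h.1.average_section π.1)).div_const _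

end IsGibbs

variable (m) in
/-- The value function as a real function, for policies with finite value. -/
def realValue (π : Policy S A) (s : S) : ℝ := (m.value π s).toReal

/-- Gibbs policies have bounded divergence, so cost and entropy parts both solve linear Bellman
equations, with solutions `u` and `w`. Because `w` charges the divergence at the current state and
`Q^π` does not, `Q^π = u + w - τ KL`. -/
theorem admissible_value (hπ : π ∈ m.admissible) :
    BddMeas (m.realValue π) ∧
      (∀ ρ : Measure S, IsProbabilityMeasure ρ →
        m.valueAt π ρ = ((∫ s, m.realValue π s ∂ρ : ℝ) : EReal)) ∧
      ∀ s, m.realValue π s = ∫ a, m.qValue π (s, a) ∂π.1 s + m.τ * (m.kl π s).toReal := by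
  obtain ⟨G, hG⟩ := exists_isGibbs hπ
  have hk := hG.bddMeas_kl
  obtain ⟨u, hu, hu'⟩ := m.bddMeas_cost.exists_eq_add_mul_average (m.stateActionKernel π)
    m.γ_pos.le m.γ_lt_one
  obtain ⟨w, hw, hw'⟩ := (hk.fst (F := A)).const_mul m.τ |>.exists_eq_add_mul_average
    (m.stateActionKernel π) m.γ_pos.le m.γ_lt_one
  have hwE := m.entropyValue_eq hw hk (fun s => ENNReal.toReal_nonneg)
    (fun s => (ENNReal.ofReal_toReal (hG.kl_ne_top s)).symm) hw'
  have huE := m.costValue_eq hu hu'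
  have hw0 := nonneg_of_eq_add_mul_average m.γ_pos.le m.γ_lt_one hw
    (fun x => mul_nonneg m.τ_pos.le ENNReal.toReal_nonneg) hw'
  have hw1 : ∀ s, 0 ≤ ∫ a, w (s, a) ∂π.1 s := fun s => integral_nonneg fun a => hw0 _
  have hval : ∀ s, m.realValue π s = ∫ a, u (s, a) ∂π.1 s + ∫ a, w (s, a) ∂π.1 s := fun s => by
    rw [realValue, value, hwE, huE, EReal.coe_ennreal_ofReal, max_eq_left (hw1 s),
      ← EReal.coe_add, EReal.toReal_coe]
  have hub := hu.average_section π.1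
  have hwb := hw.average_section π.1
  have hvb : BddMeas (m.realValue π) := by
    have : m.realValue π = _ := funext hval
    rw [this]
    exact hub.add hwb
  refine ⟨hvb, fun ρ _ => ?_, fun s => ?_⟩
  · simp_rw [valueAt, hwE, huE, hval]
    rw [integral_add (hub.integrable ρ) (hwb.integrable ρ),
      ← ofReal_integral_eq_lintegral_ofReal (hwb.integrable ρ) (ae_of_all _ hw1),
      EReal.coe_ennreal_ofReal, max_eq_left (integral_nonneg hw1), EReal.coe_add]
  · have hq : ∀ x, m.qValue π x = u x + w x - m.τ * (m.kl π x.1).toReal := fun x => by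
      have h1 : m.qValue π x = m.cost x + m.γ * ∫ s', m.realValue π s' ∂m.P x := rfl
      rw [h1, hu' x, hw' x, m.integral_stateActionKernel hu, m.integral_stateActionKernel hw]
      simp_rw [hval]
      rw [integral_add (hub.integrable _) (hwb.integrable _)]
      ring
    simp_rw [hq]
    rw [integral_sub ((hu.add hw).section_right s |>.integrable _) (integrable_const _),
      integral_add (hu.section_right s |>.integrable _) (hw.section_right s |>.integrable _), hval]
    simp

theorem bddMeas_qValue (hπ : π ∈ m.admissible) : BddMeas (m.qValue π) :=
  m.bddMeas_cost.add (((admissible_value hπ).1.average m.P).const_mul m.γ)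

variable (m) in
/-- `Q` solves the soft Bellman optimality equation. -/
def IsSoftOptimal (Q : S × A → ℝ) : Prop :=
  BddMeas Q ∧ ∀ x, Q x = m.cost x + m.γ * ∫ s', freeEnergy m.μ m.τ (fun a => Q (s', a)) ∂m.P x

variable (m) in
theorem exists_isSoftOptimal : ∃ Q, m.IsSoftOptimal Q := by
  obtain ⟨Q, hQ, h⟩ := BddMeas.exists_fixedPoint
    (fun Q x => m.cost x + m.γ * ∫ s', freeEnergy m.μ m.τ (fun a => Q (s', a)) ∂m.P x)
    (fun f hf => m.bddMeas_cost.add (((hf.freeEnergy_section m.τ_pos).average m.P).const_mul m.γ))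
    m.γ_pos.le m.γ_lt_one fun f g hf hg C hC x => by
      rw [add_sub_add_left_eq_sub, ← mul_sub,
        ← integral_sub ((hf.freeEnergy_section m.τ_pos).integrable _)
          ((hg.freeEnergy_section m.τ_pos).integrable _), abs_mul, abs_of_nonneg m.γ_pos.le]
      exact mul_le_mul_of_nonneg_left (abs_integral_le_of_forall_abs_le fun s =>
        abs_freeEnergy_sub_le m.τ_pos (hf.section_right s) (hg.section_right s)
          fun a => hC (s, a)) m.γ_pos.le
  exact ⟨Q, hQ, fun x => (h x).symm⟩

/-- The solution of the soft Bellman optimality equation bounds the value of every policy from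
below. -/
theorem IsSoftOptimal.le_valueAt {Q : S × A → ℝ} (hQ : m.IsSoftOptimal Q) (π : Policy S A)
    (ρ : Measure S) [IsProbabilityMeasure ρ] :
    ((∫ s, freeEnergy m.μ m.τ (fun a => Q (s, a)) ∂ρ : ℝ) : EReal) ≤ m.valueAt π ρ := by
  obtain ⟨hQb, hQ'⟩ := hQ
  set V : S → ℝ := fun s => freeEnergy m.μ m.τ fun a => Q (s, a) with hV
  have hVb : BddMeas V := hQb.freeEnergy_section m.τ_pos
  -- The divergence of `π` may be infinite or unbounded. It is replaced by the bounded part that the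
  -- Gibbs variational inequality guarantees: `r ≤ τ KL` and `V ≤ r + ∫ Q dπ`.
  set r : S → ℝ := fun s => max (V s - ∫ a, Q (s, a) ∂π.1 s) 0 with hr
  have hrb : BddMeas r := (hVb.sub (hQb.average_section π.1)).max_zero
  obtain ⟨u, hu, hu'⟩ := m.bddMeas_cost.exists_eq_add_mul_average (m.stateActionKernel π)
    m.γ_pos.le m.γ_lt_one
  obtain ⟨w, hw, hw'⟩ := (hrb.fst (F := A)).exists_eq_add_mul_average
    (m.stateActionKernel π) m.γ_pos.le m.γ_lt_one
  have hwE := m.ofReal_le_entropyValue hw hrb (fun s => le_max_right _ _) (fun s => by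
    simp only [hr, ENNReal.ofReal_max, ENNReal.ofReal_zero, max_eq_left zero_le]
    exact ofReal_freeEnergy_sub_le m.τ_pos (hQb.section_right s) _) hw'
  have huE := m.costValue_eq hu hu'
  have hv : BddMeas fun x => u x + w x - r x.1 := (hu.add hw).sub hrb.fst
  have hvle : ∀ s, V s ≤ r s + ∫ a, Q (s, a) ∂π.1 s := fun s => by
    linarith [le_max_left (V s - ∫ a, Q (s, a) ∂π.1 s) 0]
  have hsplit : ∀ s, ∫ a, (u (s, a) + w (s, a) - r s) ∂π.1 s
      = ∫ a, u (s, a) ∂π.1 s + ∫ a, w (s, a) ∂π.1 s - r s := fun s => by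
    rw [integral_sub ((hu.add hw).section_right s |>.integrable _) (integrable_const _),
      integral_add (hu.section_right s |>.integrable _) (hw.section_right s |>.integrable _)]
    simp
  -- `u + w - r` plays the role of `Q^π` for the reduced entropy cost; comparison with `Q` is the
  -- maximum principle.
  have hdiff : ∀ x, Q x - (u x + w x - r x.1) ≤ 0 := fun x => by
    have := le_div_of_forall_upper_bound (u := fun x => Q x - (u x + w x - r x.1)) (b := 0)
      m.γ_lt_one ((hQb.sub hv).bounded.imp fun C h x => (le_abs_self _).trans (h x))
      (fun B hB x => ?_) x
    · simpa using this
    · have h1 : Q x - (u x + w x - r x.1) = m.γ * ∫ s', (V s' -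
          (∫ a, u (s', a) ∂π.1 s' + ∫ a, w (s', a) ∂π.1 s')) ∂m.P x := by
        rw [hQ' x, hu' x, hw' x, m.integral_stateActionKernel hu,
          m.integral_stateActionKernel hw, integral_sub (hVb.integrable _)
            (((hu.average_section π.1).add (hw.average_section π.1)).integrable _),
          integral_add ((hu.average_section π.1).integrable _)
            ((hw.average_section π.1).integrable _)]
        ring
      rw [h1, zero_add]
      refine mul_le_mul_of_nonneg_left (integral_le_of_forall_le
        ((hVb.sub ((hu.average_section π.1).add (hw.average_section π.1))).integrable _)
        fun s => ?_) m.γ_pos.le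
      have h2 := integral_le_of_forall_le (ν := π.1 s)
        ((hQb.sub hv).section_right s |>.integrable _) fun a => hB (s, a)
      rw [integral_sub (hQb.section_right s |>.integrable _) (hv.section_right s |>.integrable _),
        hsplit s] at h2
      linarith [hvle s]
  have hmain : ∀ s, V s ≤ ∫ a, u (s, a) ∂π.1 s + ∫ a, w (s, a) ∂π.1 s := fun s => by
    have h2 := integral_le_of_forall_le (ν := π.1 s)
      ((hQb.sub hv).section_right s |>.integrable _) fun a => hdiff (s, a)
    rw [integral_sub (hQb.section_right s |>.integrable _) (hv.section_right s |>.integrable _),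
      hsplit s] at h2
    linarith [hvle s]
  have hub := (hu.average_section π.1).integrable ρ
  have hwb := (hw.average_section π.1).integrable ρ
  have h1 := integral_mono (hVb.integrable ρ) (hub.add hwb) hmain
  simp only [Pi.add_apply] at h1
  rw [integral_add hub hwb] at h1
  have h2 : ENNReal.ofReal (∫ s, ∫ a, w (s, a) ∂π.1 s ∂ρ) ≤ ∫⁻ s, m.entropyValue π s ∂ρ :=
    by
    rw [ofReal_integral_eq_lintegral_ofReal hwb (ae_of_all _ fun s => integral_nonneg fun a =>
      nonneg_of_eq_add_mul_average m.γ_pos.le m.γ_lt_one hw (fun x => le_max_right _ _) hw' _)]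
    exact lintegral_mono hwE
  calc ((∫ s, V s ∂ρ : ℝ) : EReal)
      ≤ ((∫ s, ∫ a, u (s, a) ∂π.1 s ∂ρ : ℝ) : EReal)
        + ((∫ s, ∫ a, w (s, a) ∂π.1 s ∂ρ : ℝ) : EReal) := by exact_mod_cast h1
    _ ≤ m.valueAt π ρ := by
        simp_rw [valueAt, huE]
        refine add_le_add le_rfl (le_trans ?_ (EReal.coe_ennreal_le_coe_ennreal_iff.2 h2))
        rw [EReal.coe_ennreal_ofReal]
        exact_mod_cast le_max_left _ _

end EntropyMDP

/-! ### Gibbs policies: the explicit actor step and comparison with the soft optimum. -/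

namespace EntropyMDP

variable {S A : Type*} [MeasurableSpace S] [MeasurableSpace A] {m : EntropyMDP S A}
  {π π' : Policy S A} {G G' Q q : S × A → ℝ}

/-- Supplies the competitor against which the actor's minimiser is tested; the normalising integral
is measurable in the state. -/
theorem exists_policy_isGibbs (hG : BddMeas G) : ∃ π : Policy S A, m.IsGibbs π G := by
  have hE : BddMeas fun x => Real.exp (-G x / m.τ) := (hG.neg.div_const _).exp
  have hZ : Measurable fun s => ∫ a, Real.exp (-G (s, a) / m.τ) ∂m.μ :=
    (hE.average_section (Kernel.const S m.μ)).measurable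
  have hd : Measurable (Function.uncurry fun s a =>
      ENNReal.ofReal (Real.exp (-G (s, a) / m.τ) / ∫ a, Real.exp (-G (s, a) / m.τ) ∂m.μ)) :=
    (hE.measurable.div (hZ.comp measurable_fst)).ennreal_ofReal
  have happly : ∀ s, (Kernel.withDensity (Kernel.const S m.μ) fun s a =>
      ENNReal.ofReal (Real.exp (-G (s, a) / m.τ) / ∫ a, Real.exp (-G (s, a) / m.τ) ∂m.μ)) s
        = gibbs m.μ m.τ fun a => G (s, a) := fun s => by
    rw [Kernel.withDensity_apply _ hd]
    rfl
  have hM : IsMarkovKernel (Kernel.withDensity (Kernel.const S m.μ) fun s a =>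
      ENNReal.ofReal (Real.exp (-G (s, a) / m.τ) / ∫ a, Real.exp (-G (s, a) / m.τ) ∂m.μ)) :=
    ⟨fun s => by rw [happly s]; exact isProbabilityMeasure_gibbs (hG.section_right s)⟩
  exact ⟨⟨_, hM⟩, hG, happly⟩

section Actor

variable {N : ℕ} {φ : S × A → EuclideanSpace ℝ (Fin N)}

theorem bddMeas_inner (hφ : Measurable φ) (hb : ∀ x, ‖φ x‖ ≤ 1) (θ : EuclideanSpace ℝ (Fin N)) :
    BddMeas fun x => (⟪θ, φ x⟫ : ℝ) :=
  ⟨measurable_const.inner hφ, ‖θ‖, fun x => (abs_real_inner_le_norm _ _).trans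
    (mul_le_of_le_one_right (norm_nonneg _) (hb x))⟩

/-- Up to a constant the advantage is `⟨θ, φ⟩ - G`, and `τ KL(p|π)` equals `∫ G dp + τ KL(p|μ)`
minus a constant. Together they are the regularised cost of the mixed potential, and the Gibbs
identity completes the square. -/
theorem actorIntegrand_eq (hφ : Measurable φ) (hb : ∀ x, ‖φ x‖ ≤ 1)
    (θ : EuclideanSpace ℝ (Fin N)) {lam : ℝ} (hlam : 0 < lam) (hG : m.IsGibbs π G) (s : S) :
    ∃ K : ℝ, ∀ p ∈ m.admissible,
      m.τ * lam * m.actorIntegrand φ lam p π θ s = K + m.τ *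
        (InformationTheory.klDiv (p.1 s) (gibbs m.μ m.τ fun a =>
          (1 - m.τ * lam) * G (s, a) + m.τ * lam * ⟪θ, φ (s, a)⟫)).toReal := by
  have hτ := m.τ_pos
  have hq := (bddMeas_inner hφ hb θ).section_right s
  have hGs := hG.1.section_right s
  have hG' := (hGs.const_mul (1 - m.τ * lam)).add (hq.const_mul (m.τ * lam))
  set C := (freeEnergy m.μ m.τ fun a => G (s, a)) - ∫ a', m.softQ φ θ π s a' ∂π.1 s with hC
  refine ⟨m.τ * lam * C - (freeEnergy m.μ m.τ fun a => G (s, a)) + freeEnergy m.μ m.τ fun a =>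
    (1 - m.τ * lam) * G (s, a) + m.τ * lam * ⟪θ, φ (s, a)⟫, fun p hp => ?_⟩
  obtain ⟨H, hH⟩ := exists_isGibbs hp
  have hkl : InformationTheory.klDiv (p.1 s) m.μ ≠ ⊤ := hH.kl_ne_top s
  have hac : p.1 s ≪ m.μ := by rw [hH.2 s]; exact gibbs_absolutelyContinuous
  have hA : ∫ a, m.approxAdvantage φ θ π s a ∂p.1 s
      = ∫ a, ⟪θ, φ (s, a)⟫ ∂p.1 s - ∫ a, G (s, a) ∂p.1 s + C := by
    have h1 : m.approxAdvantage φ θ π s =ᵐ[p.1 s] fun a => ⟪θ, φ (s, a)⟫ - G (s, a) + C := by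
      filter_upwards [hac.ae_le (log_rnDeriv_gibbs (μ := m.μ) hτ.ne' hGs)] with a ha
      rw [approxAdvantage, softQ, hG.2 s, ha, hC, hG.2 s]
      ring
    rw [integral_congr_ae h1, integral_add ((hq.sub hGs).integrable _) (integrable_const _),
      integral_sub (hq.integrable _) (hGs.integrable _)]
    simp
  have h1 := integral_add_mul_klDiv hτ.ne' hGs hkl
  have h2 := integral_add_mul_klDiv hτ.ne' hG' hkl
  rw [integral_add ((hGs.const_mul _).integrable _) ((hq.const_mul _).integrable _),
    integral_const_mul, integral_const_mul] at h2
  rw [actorIntegrand, hA, hG.2 s]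
  have h3 : m.τ * lam * (1 / lam * (InformationTheory.klDiv (p.1 s)
      (gibbs m.μ m.τ fun a => G (s, a))).toReal) = m.τ * (InformationTheory.klDiv (p.1 s)
      (gibbs m.μ m.τ fun a => G (s, a))).toReal := by
    field_simp
  rw [mul_add, h3]
  linarith

/-- The pointwise minimiser of the actor objective is the explicit mirror descent update. -/
theorem IsGibbs.actor_step (hφ : Measurable φ) (hb : ∀ x, ‖φ x‖ ≤ 1)
    (θ : EuclideanSpace ℝ (Fin N)) {lam : ℝ} (hlam : 0 < lam) (hG : m.IsGibbs π G)
    (hπ' : π' ∈ m.admissible)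
    (hmin : ∀ s, IsMinOn (fun p => m.actorIntegrand φ lam p π θ s) m.admissible π') :
    m.IsGibbs π' fun x => (1 - m.τ * lam) * G x + m.τ * lam * ⟪θ, φ x⟫ := by
  have hτ := m.τ_pos
  have hG' := (hG.1.const_mul (1 - m.τ * lam)).add ((bddMeas_inner hφ hb θ).const_mul (m.τ * lam))
  obtain ⟨p, hp⟩ := exists_policy_isGibbs (m := m) hG'
  refine ⟨hG', fun s => ?_⟩
  obtain ⟨K, hK⟩ := actorIntegrand_eq hφ hb θ hlam hG s
  have h1 := mul_le_mul_of_nonneg_left (isMinOn_iff.1 (hmin s) p hp.mem_admissible)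
    (mul_nonneg hτ.le hlam.le)
  rw [hK _ hπ', hK _ hp.mem_admissible, hp.2 s] at h1
  have hpr := isProbabilityMeasure_gibbs (μ := m.μ) (τ := m.τ) (hG'.section_right s)
  rw [InformationTheory.klDiv_self] at h1
  obtain ⟨H, hH⟩ := exists_isGibbs hπ'
  -- Finiteness is needed because `toReal` also sends `⊤` to `0`.
  have h2 := klDiv_gibbs_right_ne_top (τ := m.τ) (hG'.section_right s) (hH.kl_ne_top s)
  have h3 : (InformationTheory.klDiv (π'.1 s) (gibbs m.μ m.τ fun a =>
      (1 - m.τ * lam) * G (s, a) + m.τ * lam * ⟪θ, φ (s, a)⟫)).toReal = 0 := by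
    refine le_antisymm ?_ ENNReal.toReal_nonneg
    simp only [ENNReal.toReal_zero, mul_zero, add_zero] at h1
    exact nonpos_of_mul_nonpos_right (by linarith) hτ
  rw [← InformationTheory.klDiv_eq_zero_iff]
  exact ((ENNReal.toReal_eq_zero_iff _).1 h3).resolve_right h2

end Actor

section Comparison

theorem IsGibbs.bddMeas_realValue (hG : m.IsGibbs π G) : BddMeas (m.realValue π) :=
  (admissible_value hG.mem_admissible).1

theorem IsGibbs.bddMeas_qValue (hG : m.IsGibbs π G) : BddMeas (m.qValue π) :=
  m.bddMeas_qValue hG.mem_admissible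

theorem IsGibbs.realValue_eq (hG : m.IsGibbs π G) (s : S) :
    m.realValue π s = ∫ a, m.qValue π (s, a) ∂π.1 s + m.τ * (m.kl π s).toReal :=
  (admissible_value hG.mem_admissible).2.2 s

theorem IsGibbs.freeEnergy_le (hG : m.IsGibbs π G) {f : S × A → ℝ} (hf : BddMeas f) (s : S) :
    freeEnergy m.μ m.τ (fun a => f (s, a))
      ≤ ∫ a, f (s, a) ∂π.1 s + m.τ * (m.kl π s).toReal :=
  _root_.freeEnergy_le m.τ_pos (hf.section_right s) (hG.kl_ne_top s)

theorem integral_section_le_add (π : Policy S A) {f g : S × A → ℝ} (hf : BddMeas f)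
    (hg : BddMeas g) {d : ℝ} (h : ∀ x, f x ≤ g x + d) (s : S) :
    ∫ a, f (s, a) ∂π.1 s ≤ ∫ a, g (s, a) ∂π.1 s + d := by
  have := integral_le_of_forall_le (ν := π.1 s)
    ((hf.section_right s).sub (hg.section_right s) |>.integrable _)
    (fun a => sub_le_iff_le_add'.2 (h (s, a)))
  rw [integral_sub (hf.section_right s |>.integrable _) (hg.section_right s |>.integrable _)]
    at this
  linarith

theorem qValue_le_of_realValue_le (hG : m.IsGibbs π G) (hG' : m.IsGibbs π' G') {b : ℝ}
    (h : ∀ s, m.realValue π' s ≤ m.realValue π s + b) (x : S × A) :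
    m.qValue π' x ≤ m.qValue π x + m.γ * b := by
  have := integral_le_of_forall_le (ν := m.P x)
    (hG'.bddMeas_realValue.sub hG.bddMeas_realValue |>.integrable _)
    (fun s => sub_le_iff_le_add'.2 (h s))
  rw [integral_sub (hG'.bddMeas_realValue.integrable _) (hG.bddMeas_realValue.integrable _)] at this
  have h2 := mul_le_mul_of_nonneg_left this m.γ_pos.le
  change m.cost x + m.γ * ∫ s', m.realValue π' s' ∂m.P x
    ≤ m.cost x + m.γ * ∫ s', m.realValue π s' ∂m.P x + m.γ * b
  linarith

theorem IsSoftOptimal.bddMeas_freeEnergy_sub (hG : m.IsGibbs π G) (hQ : m.IsSoftOptimal Q) :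
    BddMeas fun s => freeEnergy m.μ m.τ (fun a => Q (s, a)) - m.realValue π s :=
  (hQ.1.freeEnergy_section m.τ_pos).sub hG.bddMeas_realValue

theorem IsSoftOptimal.qValue_sub (hG : m.IsGibbs π G) (hQ : m.IsSoftOptimal Q)
    (x : S × A) :
    m.qValue π x - Q x
      = m.γ * ∫ s, (m.realValue π s - freeEnergy m.μ m.τ fun a => Q (s, a)) ∂m.P x := by
  rw [integral_sub (hG.bddMeas_realValue.integrable _)
    ((hQ.1.freeEnergy_section m.τ_pos).integrable _), hQ.2 x]
  change m.cost x + m.γ * ∫ s', m.realValue π s' ∂m.P x - _ = _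
  ring

theorem IsSoftOptimal.qValue_le_add (hG : m.IsGibbs π G) (hQ : m.IsSoftOptimal Q) {b : ℝ}
    (h : ∀ s, m.realValue π s ≤ freeEnergy m.μ m.τ (fun a => Q (s, a)) + b) (x : S × A) :
    m.qValue π x ≤ Q x + m.γ * b := by
  have h1 := integral_le_of_forall_le (ν := m.P x) (hG.bddMeas_realValue.sub
    (hQ.1.freeEnergy_section m.τ_pos) |>.integrable _) (fun s => sub_le_iff_le_add'.2 (h s))
  have h2 := mul_le_mul_of_nonneg_left h1 m.γ_pos.le
  rw [← hQ.qValue_sub hG] at h2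
  linarith

theorem IsSoftOptimal.le_qValue_add (hG : m.IsGibbs π G) (hQ : m.IsSoftOptimal Q) {b : ℝ}
    (h : ∀ s, freeEnergy m.μ m.τ (fun a => Q (s, a)) ≤ m.realValue π s + b) (x : S × A) :
    Q x ≤ m.qValue π x + m.γ * b := by
  have h1 := le_integral_of_forall_le (ν := m.P x) (C := -b) (hG.bddMeas_realValue.sub
    (hQ.1.freeEnergy_section m.τ_pos) |>.integrable _) (fun s => by linarith [h s])
  have h2 := mul_le_mul_of_nonneg_left h1 m.γ_pos.le
  rw [← hQ.qValue_sub hG] at h2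
  linarith

/-- If the optimum exceeds the value by at most `B`, one Bellman step and the variational inequality
improve this to `γB`. -/
theorem IsSoftOptimal.le_realValue (hG : m.IsGibbs π G) (hQ : m.IsSoftOptimal Q)
    (s : S) :
    freeEnergy m.μ m.τ (fun a => Q (s, a)) ≤ m.realValue π s := by
  have := le_div_of_forall_upper_bound (b := 0) m.γ_lt_one
    ((hQ.bddMeas_freeEnergy_sub hG).bounded.imp fun C h s => (le_abs_self _).trans (h s))
    (fun B hB s => by
      have h1 := hQ.le_qValue_add hG (b := B) fun s => by linarith [hB s]
      have h2 := integral_section_le_add π hQ.1 hG.bddMeas_qValue h1 s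
      have h3 := hG.freeEnergy_le hQ.1 s
      rw [hG.realValue_eq s]
      linarith) s
  rw [zero_div] at this
  linarith

theorem IsSoftOptimal.le_qValue (hG : m.IsGibbs π G) (hQ : m.IsSoftOptimal Q)
    (x : S × A) : Q x ≤ m.qValue π x := by
  simpa using hQ.le_qValue_add hG (b := 0) (fun s => by simpa using hQ.le_realValue hG s) x

/-- Replacing `Q^π` by `G` costs `p` and gives exactly the free energy of `G`; the free energy is
nonexpansive, which costs `g`. This is the global estimate. -/
theorem IsSoftOptimal.realValue_le_add (hG : m.IsGibbs π G) (hQ : m.IsSoftOptimal Q)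
    {p g : ℝ} (hp : ∀ x, m.qValue π x ≤ G x + p)
    (hg : ∀ x, |G x - Q x| ≤ g) (s : S) :
    m.realValue π s ≤ freeEnergy m.μ m.τ (fun a => Q (s, a)) + (p + g) := by
  have h1 := integral_section_le_add π hG.bddMeas_qValue hG.1 hp s
  have h2 := hG.integral_add_mul_kl s
  have h3 := freeEnergy_le_freeEnergy_add (μ := m.μ) m.τ_pos (hG.1.section_right s)
    (hQ.1.section_right s) (d := g) fun a => by linarith [(abs_le.1 (hg (s, a))).2]
  rw [hG.realValue_eq s]
  linarith

/-- Near the optimum the Gibbs policy of `G` is suboptimal only to second order for the potential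
`Q`; iterating the Bellman equation sums this loss to the factor `1/(1-γ)`. -/
theorem IsSoftOptimal.realValue_le_add_sq (hG : m.IsGibbs π G) (hQ : m.IsSoftOptimal Q)
    {g : ℝ} (hg : ∀ x, |G x - Q x| ≤ g) (hgτ : g ≤ m.τ)
    (s : S) :
    m.realValue π s ≤ freeEnergy m.μ m.τ (fun a => Q (s, a)) + g ^ 2 / m.τ / (1 - m.γ) := by
  have := le_div_of_forall_upper_bound (b := g ^ 2 / m.τ)
    (u := fun s => m.realValue π s - freeEnergy m.μ m.τ (fun a => Q (s, a))) m.γ_lt_one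
    ((hG.bddMeas_realValue.sub (hQ.1.freeEnergy_section m.τ_pos)).bounded.imp
      fun C h s => (le_abs_self _).trans (h s))
    (fun B hB s => by
      have h1 := hQ.qValue_le_add hG (b := B) fun s => by linarith [hB s]
      have h2 := integral_section_le_add π hG.bddMeas_qValue hQ.1 h1 s
      have h3 := integral_add_mul_klDiv_gibbs_le (μ := m.μ) m.τ_pos (hQ.1.section_right s)
        (hG.1.section_right s) (d := g) (fun a => by rw [abs_sub_comm]; exact hg (s, a)) hgτ
      rw [← hG.2 s, ← kl] at h3
      rw [hG.realValue_eq s]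
      linarith) s
  linarith

/-- Approximate policy improvement for the mirror descent update. -/
theorem IsGibbs.realValue_step_le (hG : m.IsGibbs π G) {α e : ℝ} (h0 : 0 < α) (h1 : α ≤ 1) (hq : BddMeas q)
    (hG' : m.IsGibbs π' fun x => (1 - α) * G x + α * q x)
    (he : ∀ x, |q x - m.qValue π x| ≤ e) (s : S) :
    m.realValue π' s ≤ m.realValue π s + 2 * e / (1 - m.γ) := by
  -- `π'` minimises the `(1-α, α)` mixture of the regularised costs of `G` and `q`, while `π`
  -- minimises the one for `G`. Hence the one for `q` cannot increase.
  have himp : ∀ s, ∫ a, q (s, a) ∂π'.1 s + m.τ * (m.kl π' s).toReal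
      ≤ ∫ a, q (s, a) ∂π.1 s + m.τ * (m.kl π s).toReal := fun s => by
    have hmin : ∀ p : Policy S A, ∫ a, ((1 - α) * G (s, a) + α * q (s, a)) ∂p.1 s
        = (1 - α) * ∫ a, G (s, a) ∂p.1 s + α * ∫ a, q (s, a) ∂p.1 s := fun p => by
      rw [integral_add ((hG.1.section_right s).const_mul _ |>.integrable _)
        ((hq.section_right s).const_mul _ |>.integrable _), integral_const_mul, integral_const_mul]
    have h2 := hG'.integral_add_mul_kl s
    have h3 := hG.freeEnergy_le hG'.1 s
    have h4 := hG.integral_add_mul_kl s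
    have h5 := hG'.freeEnergy_le hG.1 s
    simp only [hmin] at h2 h3
    have h6 := mul_le_mul_of_nonneg_left (h4.le.trans h5) (sub_nonneg.2 h1)
    refine le_of_mul_le_mul_left ?_ h0
    linarith
  have := le_div_of_forall_upper_bound (b := 2 * e)
    (u := fun s => m.realValue π' s - m.realValue π s) m.γ_lt_one
    ((hG'.bddMeas_realValue.sub hG.bddMeas_realValue).bounded.imp
      fun C h s => (le_abs_self _).trans (h s))
    (fun B hB s => by
      have h2 := qValue_le_of_realValue_le hG hG' (b := B) fun s => by linarith [hB s]
      have h3 := integral_section_le_add π' hG'.bddMeas_qValue hG.bddMeas_qValue h2 s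
      have h4 := integral_section_le_add π' hG.bddMeas_qValue hq (d := e)
        (fun x => by linarith [(abs_le.1 (he x)).1]) s
      have h5 := integral_section_le_add π hq hG.bddMeas_qValue (d := e)
        (fun x => by linarith [(abs_le.1 (he x)).2]) s
      rw [hG.realValue_eq s, hG'.realValue_eq s]
      linarith [himp s]) s
  linarith

theorem IsGibbs.qValue_step_le (hG : m.IsGibbs π G) {α e : ℝ} (h0 : 0 < α) (h1 : α ≤ 1) (hq : BddMeas q)
    (hG' : m.IsGibbs π' fun x => (1 - α) * G x + α * q x)
    (he : ∀ x, |q x - m.qValue π x| ≤ e) (x : S × A) :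
    m.qValue π' x ≤ m.qValue π x + m.γ * (2 * e / (1 - m.γ)) :=
  qValue_le_of_realValue_le hG hG' (hG.realValue_step_le h0 h1 hq hG' he) x

end Comparison

end EntropyMDP

/-! ### Discounted occupancy measures and coercivity. -/

section Occupancy

variable {E : Type*} [MeasurableSpace E] {γ : ℝ} {κ : Kernel E E}

/-- Splitting off the term `n = 0` gives the flow equation `d = (1-γ) ν + γ dκ`, the source of the
inequalities below. -/
theorem occupancy_eq (h0 : 0 ≤ γ) (ν : Measure E) :
    occupancy γ κ ν
      = ENNReal.ofReal (1 - γ) • ν + ENNReal.ofReal γ • (occupancy γ κ ν).bind κ := by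
  ext s hs
  have hsum : (occupancy γ κ ν).bind κ s = ∑' n : ℕ, ENNReal.ofReal ((1 - γ) * γ ^ n) *
      ((fun m : Measure E => m.bind κ)^[n + 1] ν) s := by
    rw [Measure.bind_apply hs (Kernel.aemeasurable _), occupancy, lintegral_sum_measure]
    refine tsum_congr fun n => ?_
    rw [lintegral_smul_measure, Function.iterate_succ_apply',
      Measure.bind_apply hs (Kernel.aemeasurable _), smul_eq_mul]
  rw [Measure.add_apply, Measure.smul_apply, Measure.smul_apply, hsum, smul_eq_mul, smul_eq_mul,
    ← ENNReal.tsum_mul_left, occupancy, Measure.sum_apply _ hs, tsum_eq_zero_add' ENNReal.summable]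
  congr 1
  · simp
  · refine tsum_congr fun n => ?_
    rw [← mul_assoc, ← ENNReal.ofReal_mul h0, Measure.smul_apply, smul_eq_mul]
    congr 2
    ring

variable [IsMarkovKernel κ] {ν : Measure E} [IsProbabilityMeasure ν]

theorem isProbabilityMeasure_occupancy (h0 : 0 ≤ γ) (h1 : γ < 1) :
    IsProbabilityMeasure (occupancy γ κ ν) := by
  have hiter : ∀ n, IsProbabilityMeasure ((fun m : Measure E => m.bind κ)^[n] ν) := fun n => by
    induction n with
    | zero => assumption
    | succ n ih => rw [Function.iterate_succ_apply']; infer_instance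
  refine ⟨?_⟩
  rw [occupancy, Measure.sum_apply _ MeasurableSet.univ]
  simp only [Measure.smul_apply, measure_univ, smul_eq_mul, mul_one]
  rw [← ENNReal.ofReal_tsum_of_nonneg
      (fun n => mul_nonneg (sub_nonneg.2 h1.le) (pow_nonneg h0 n))
      ((summable_geometric_of_lt_one h0 h1).mul_left _),
    tsum_mul_left, tsum_geometric_of_lt_one h0 h1, mul_inv_cancel₀ (sub_pos.2 h1).ne',
    ENNReal.ofReal_one]

theorem integral_occupancy (h0 : 0 ≤ γ) (h1 : γ < 1) {f : E → ℝ} (hf : BddMeas f) :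
    ∫ x, f x ∂occupancy γ κ ν
      = (1 - γ) * ∫ x, f x ∂ν + γ * ∫ x, ∫ y, f y ∂κ x ∂occupancy γ κ ν := by
  have := isProbabilityMeasure_occupancy (κ := κ) (ν := ν) h0 h1
  conv_lhs => rw [occupancy_eq h0]
  rw [integral_add_measure ((hf.integrable _).smul_measure ENNReal.ofReal_ne_top)
      ((hf.integrable _).smul_measure ENNReal.ofReal_ne_top),
    integral_smul_measure, integral_smul_measure, integral_bind_kernel _ _ hf,
    ENNReal.toReal_ofReal h0, ENNReal.toReal_ofReal (sub_nonneg.2 h1.le), smul_eq_mul, smul_eq_mul]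

theorem mul_integral_le_integral_occupancy (h0 : 0 ≤ γ) (h1 : γ < 1) {f : E → ℝ}
    (hf : BddMeas f) (hf0 : ∀ x, 0 ≤ f x) :
    (1 - γ) * ∫ x, f x ∂ν ≤ ∫ x, f x ∂occupancy γ κ ν := by
  have h2 : 0 ≤ ∫ x, ∫ y, f y ∂κ x ∂occupancy γ κ ν :=
    integral_nonneg fun x => integral_nonneg hf0
  rw [integral_occupancy h0 h1 hf]
  nlinarith

theorem integral_average_occupancy_le (h0 : 0 ≤ γ) (h1 : γ < 1) {f : E → ℝ}
    (hf : BddMeas f) (hf0 : ∀ x, 0 ≤ f x) :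
    γ * ∫ x, ∫ y, f y ∂κ x ∂occupancy γ κ ν ≤ ∫ x, f x ∂occupancy γ κ ν := by
  have h2 : 0 ≤ ∫ x, f x ∂ν := integral_nonneg hf0
  rw [integral_occupancy h0 h1 hf]
  nlinarith

theorem sq_average_le (κ : Kernel E E) [IsMarkovKernel κ] {f : E → ℝ} (hf : BddMeas f) (x : E) :
    (∫ y, f y ∂κ x) ^ 2 ≤ ∫ y, f y ^ 2 ∂κ x := by
  set c := ∫ y, f y ∂κ x with hc
  have h2 : BddMeas fun y => f y ^ 2 := by simpa only [sq] using hf.mul hf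
  have h : 0 ≤ ∫ y, (f y ^ 2 - 2 * c * f y + c ^ 2) ∂κ x := integral_nonneg fun y => by
    have := sq_nonneg (f y - c)
    simp only [Pi.zero_apply]
    linarith
  rw [integral_add ((h2.sub (hf.const_mul (2 * c))).integrable _) (integrable_const _),
    integral_sub (h2.integrable _) ((hf.const_mul _).integrable _), integral_const_mul, ← hc] at h
  simp only [integral_const, probReal_univ, one_smul] at h
  linarith

/-- The operator `1 - γ κ` is coercive on `L²` of the discounted occupancy measure. -/
theorem coercive_occupancy (h0 : 0 ≤ γ) (h1 : γ < 1) {f : E → ℝ} (hf : BddMeas f) :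
    (1 - √γ) * ∫ x, f x ^ 2 ∂occupancy γ κ ν
      ≤ ∫ x, (f x - γ * ∫ y, f y ∂κ x) * f x ∂occupancy γ κ ν := by
  have := isProbabilityMeasure_occupancy (κ := κ) (ν := ν) h0 h1
  have hs := Real.sq_sqrt h0
  have hs0 := Real.sqrt_nonneg γ
  set t := √γ with ht
  have h2 : BddMeas fun y => f y ^ 2 := by simpa only [sq] using hf.mul hf
  have hk := hf.average κ
  have hk2 := h2.average κ
  have h3 := integral_average_occupancy_le (κ := κ) (ν := ν) h0 h1 h2 fun x => sq_nonneg _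
  -- Young's inequality for `γ f (κf)`, weighted by `√γ` so that both halves cost `√γ/2` once `γ ∫
  -- κ(f²) ≤ ∫ f²` is used, and then Jensen.
  have hpt : ∀ x, f x ^ 2 - (t / 2 * f x ^ 2 + t / 2 * (γ * ∫ y, f y ^ 2 ∂κ x))
      ≤ (f x - γ * ∫ y, f y ∂κ x) * f x := fun x => by
    have h4 := sq_average_le κ hf x
    have h5 : 0 ≤ t * (f x - t * ∫ y, f y ∂κ x) ^ 2 := mul_nonneg hs0 (sq_nonneg _)
    have h6 : 0 ≤ t * γ * (∫ y, f y ^ 2 ∂κ x - (∫ y, f y ∂κ x) ^ 2) :=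
      mul_nonneg (mul_nonneg hs0 h0) (sub_nonneg.2 h4)
    rw [← hs] at h6 ⊢
    linarith
  have h7 := integral_mono
    ((h2.sub ((h2.const_mul (t / 2)).add ((hk2.const_mul γ).const_mul (t / 2)))).integrable
      (occupancy γ κ ν))
    (((hf.sub (hk.const_mul γ)).mul hf).integrable (occupancy γ κ ν)) hpt
  rw [integral_sub (h2.integrable _)
      (((h2.const_mul (t / 2)).add ((hk2.const_mul γ).const_mul (t / 2))).integrable _),
    integral_add ((h2.const_mul (t / 2)).integrable _)
      (((hk2.const_mul γ).const_mul (t / 2)).integrable _), integral_const_mul,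
    integral_const_mul, integral_const_mul] at h7
  have h8 := mul_le_mul_of_nonneg_left h3 (by linarith : 0 ≤ t / 2)
  linarith

/-- Both measures have mass one, so a density bounded by `ξ` forces `1 ≤ ξ`. -/
theorem one_le_of_rnDeriv_occupancy_le (h0 : 0 ≤ γ) (h1 : γ < 1) {ξ : ℝ}
    (hac : occupancy γ κ ν ≪ ν)
    (hξ : ∀ᵐ s ∂ν, (occupancy γ κ ν).rnDeriv ν s ≤ ENNReal.ofReal ξ) : 1 ≤ ξ := by
  have := isProbabilityMeasure_occupancy (κ := κ) (ν := ν) h0 h1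
  have h2 := lintegral_mono_ae hξ
  rw [Measure.lintegral_rnDeriv hac, measure_univ, lintegral_const, measure_univ, mul_one] at h2
  by_contra! h
  exact absurd h2 (not_le.2 (by simpa using (ENNReal.ofReal_lt_one).2 h))

end Occupancy

/-! ### The smallest eigenvalue of the feature covariance. -/

section Covariance

variable {E : Type*} [MeasurableSpace E] {N : ℕ} {φ : E → EuclideanSpace ℝ (Fin N)}

/-- Expand the quadratic form in the orthonormal eigenbasis and bound each eigenvalue from below. -/
theorem iInf_eigenvalues_mul_le {C : Matrix (Fin N) (Fin N) ℝ} (hC : C.IsHermitian)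
    (v : EuclideanSpace ℝ (Fin N)) :
    (⨅ i, hC.eigenvalues i) * ‖v‖ ^ 2 ≤ ∑ i, ∑ j, v i * C i j * v j := by
  set T := Matrix.toEuclideanLin C with hT
  have hsym : T.IsSymmetric := Matrix.isSymmetric_toEuclideanLin_iff.2 hC
  have hTv : (⟪v, T v⟫ : ℝ) = ∑ i, ∑ j, v i * C i j * v j := by
    simp only [hT, PiLp.inner_apply, Matrix.toLpLin_apply, Matrix.mulVec, dotProduct,
      RCLike.inner_apply, conj_trivial, Finset.sum_mul]
    refine Finset.sum_congr rfl fun i _ => Finset.sum_congr rfl fun j _ => by ring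
  rw [← hTv, ← hC.eigenvectorBasis.sum_inner_mul_inner v (T v),
    ← hC.eigenvectorBasis.sum_sq_norm_inner_right v, Finset.mul_sum]
  refine Finset.sum_le_sum fun i _ => ?_
  have h1 : T (hC.eigenvectorBasis i) = hC.eigenvalues i • hC.eigenvectorBasis i := by
    have := hC.mulVec_eigenvectorBasis i
    rw [hT, Matrix.toLpLin_apply, this]
    rfl
  rw [← hsym, h1, real_inner_smul_left, real_inner_comm v, Real.norm_eq_abs, sq_abs]
  have h2 := ciInf_le (Set.finite_range hC.eigenvalues).bddBelow i
  nlinarith [sq_nonneg (⟪hC.eigenvectorBasis i, v⟫ : ℝ)]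

theorem minEigenvalue_mul_le (hφ : Measurable φ) (hb : ∀ x, ‖φ x‖ ≤ 1) (β : Measure E)
    [IsProbabilityMeasure β] (v : EuclideanSpace ℝ (Fin N)) :
    minEigenvalue φ β * ‖v‖ ^ 2 ≤ ∫ x, (⟪v, φ x⟫ : ℝ) ^ 2 ∂β := by
  refine (iInf_eigenvalues_mul_le (featureCov_isHermitian φ β) v).trans (le_of_eq ?_)
  have hφi : ∀ i, BddMeas fun x => φ x i := fun i =>
    ⟨by fun_prop, 1, fun x => (PiLp.norm_apply_le (φ x) i).trans (hb x)⟩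
  have h1 : ∀ x, (⟪v, φ x⟫ : ℝ) ^ 2 = ∑ i, ∑ j, v i * v j * (φ x i * φ x j) := fun x => by
    rw [PiLp.inner_apply, sq, Finset.sum_mul_sum]
    refine Finset.sum_congr rfl fun i _ => Finset.sum_congr rfl fun j _ => ?_
    simp only [RCLike.inner_apply, conj_trivial]
    ring
  simp_rw [h1]
  rw [integral_finsetSum _ fun i _ => integrable_finsetSum _ fun j _ =>
    ((hφi i).mul (hφi j)).const_mul _ |>.integrable _]
  refine Finset.sum_congr rfl fun i _ => ?_
  rw [integral_finsetSum _ fun j _ => ((hφi i).mul (hφi j)).const_mul _ |>.integrable _]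
  refine Finset.sum_congr rfl fun j _ => ?_
  rw [integral_const_mul, featureCov, Matrix.of_apply]
  ring

/-- The parameter is controlled by the function it represents. -/
theorem sqrt_minEigenvalue_mul_norm_le (hφ : Measurable φ) (hb : ∀ x, ‖φ x‖ ≤ 1) (β : Measure E)
    [IsProbabilityMeasure β] {v : EuclideanSpace ℝ (Fin N)} {C : ℝ}
    (h : ∀ x, |(⟪v, φ x⟫ : ℝ)| ≤ C) : √(minEigenvalue φ β) * ‖v‖ ≤ C := by
  have hv : BddMeas fun x => (⟪v, φ x⟫ : ℝ) := ⟨measurable_const.inner hφ, C, h⟩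
  have hne : Nonempty E := nonempty_of_isProbabilityMeasure β
  obtain ⟨x⟩ := hne
  have hC : 0 ≤ C := (abs_nonneg _).trans (h x)
  by_cases hm : 0 ≤ minEigenvalue φ β
  · refine le_of_sq_le_sq ?_ hC
    rw [mul_pow, Real.sq_sqrt hm]
    refine (minEigenvalue_mul_le hφ hb β v).trans (integral_le_of_forall_le ?_ fun x => ?_)
    · simpa only [sq] using (hv.mul hv).integrable β
    · exact sq_le_sq' (abs_le.1 (h x)).1 (abs_le.1 (h x)).2
  · rw [Real.sqrt_eq_zero_of_nonpos (not_le.1 hm).le, zero_mul]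
    exact hC

end Covariance

/-! ### Contraction of the temporal-difference critic. -/

namespace EntropyMDP

variable {S A : Type*} [MeasurableSpace S] [MeasurableSpace A] {m : EntropyMDP S A}
  {π : Policy S A} {N : ℕ} {φ : S × A → EuclideanSpace ℝ (Fin N)}

theorem bellman_qValue (hπ : π ∈ m.admissible) (x : S × A) :
    m.bellman π (m.qValue π) x = m.qValue π x := by
  obtain ⟨G, hG⟩ := exists_isGibbs hπ
  have h1 : m.qValue π x = m.cost x + m.γ * ∫ s', m.realValue π s' ∂m.P x := rfl
  rw [h1, bellman, m.integral_stateActionKernel (m.bddMeas_qValue hπ)]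
  simp_rw [hG.realValue_eq]
  rw [integral_add ((hG.bddMeas_qValue.average_section π.1).integrable _)
    ((hG.bddMeas_kl.const_mul _).integrable _), integral_const_mul]
  ring

/-- Subtracting the Bellman equation of `Q^π` cancels cost and entropy, so the semi-gradient is
linear in `θ - θπ`. -/
theorem semiGradient_eq (hφ : Measurable φ) (hb : ∀ x, ‖φ x‖ ≤ 1) (β : Measure (S × A))
    (hπ : π ∈ m.admissible) {θπ : EuclideanSpace ℝ (Fin N)}
    (hθ : ∀ x, m.qValue π x = ⟪θπ, φ x⟫) (θ : EuclideanSpace ℝ (Fin N)) :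
    m.semiGradient φ β θ π = ∫ x, ((⟪θ - θπ, φ x⟫ : ℝ)
      - m.γ * ∫ y, (⟪θ - θπ, φ y⟫ : ℝ) ∂m.stateActionKernel π x) • φ x
        ∂occupancy m.γ (m.stateActionKernel π) β := by
  rw [semiGradient]
  congr 1
  ext1 x
  congr 1
  have h1 := bellman_qValue hπ x
  rw [funext hθ] at h1
  simp_rw [inner_sub_left]
  rw [integral_sub ((bddMeas_inner hφ hb θ).integrable _) ((bddMeas_inner hφ hb θπ).integrable _)]
  rw [bellman] at h1 ⊢
  linarith

/-- One temporal difference step contracts towards the parameter of the true value. -/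
theorem norm_critic_step_le (hφ : Measurable φ) (hb : ∀ x, ‖φ x‖ ≤ 1) (β : Measure (S × A))
    [IsProbabilityMeasure β] (hπ : π ∈ m.admissible)
    {θπ : EuclideanSpace ℝ (Fin N)} (hθ : ∀ x, m.qValue π x = ⟪θπ, φ x⟫)
    {h : ℝ} (h_pos : 0 < h) (h_small : h < m.gammaConst φ β / (2 * (1 + m.γ)))
    (θ : EuclideanSpace ℝ (Fin N)) :
    ‖θ - h • m.semiGradient φ β θ π - θπ‖
      ≤ Real.exp (-(h * m.gammaConst φ β / 2)) * ‖θ - θπ‖ := by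
  have h0 := m.γ_pos
  have h1 := m.γ_lt_one
  have := isProbabilityMeasure_occupancy (κ := m.stateActionKernel π) (ν := β) h0.le h1
  set d := occupancy m.γ (m.stateActionKernel π) β with hd
  set v := θ - θπ with hv
  set g := m.semiGradient φ β θ π with hg
  set Γ := m.gammaConst φ β with hΓ
  set f : S × A → ℝ := fun x => ⟪v, φ x⟫ with hf
  have hfb : BddMeas f := bddMeas_inner hφ hb v
  have hk := hfb.average (m.stateActionKernel π)
  have hfv : ∀ x, |f x| ≤ ‖v‖ := fun x => (abs_real_inner_le_norm _ _).trans
    (mul_le_of_le_one_right (norm_nonneg _) (hb x))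
  have hgd : g = ∫ x, (f x - m.γ * ∫ y, f y ∂m.stateActionKernel π x) • φ x ∂d :=
    semiGradient_eq hφ hb β hπ hθ θ
  have hres : ∀ x, |f x - m.γ * ∫ y, f y ∂m.stateActionKernel π x| ≤ (1 + m.γ) * ‖v‖ := fun x => by
    have h2 := abs_integral_le_of_forall_abs_le (ν := m.stateActionKernel π x) hfv
    calc _ ≤ |f x| + |m.γ * ∫ y, f y ∂m.stateActionKernel π x| := abs_sub _ _
      _ ≤ ‖v‖ + m.γ * ‖v‖ := by
        rw [abs_mul, abs_of_pos h0]
        exact add_le_add (hfv x) (mul_le_mul_of_nonneg_left h2 h0.le)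
      _ = _ := by ring
  have hpt : ∀ x, ‖(f x - m.γ * ∫ y, f y ∂m.stateActionKernel π x) • φ x‖ ≤ (1 + m.γ) * ‖v‖ :=
    fun x => by
      rw [norm_smul]
      exact (mul_le_of_le_one_right (norm_nonneg _) (hb x)).trans (hres x)
  have hgn : ‖g‖ ≤ (1 + m.γ) * ‖v‖ := by
    rw [hgd]
    simpa using norm_integral_le_of_norm_le_const (μ := d) (ae_of_all _ hpt)
  have hint : Integrable (fun x =>
      (f x - m.γ * ∫ y, f y ∂m.stateActionKernel π x) • φ x) d :=
    Integrable.of_bound ((hfb.sub (hk.const_mul _)).measurable.smul hφ).aestronglyMeasurable _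
      (ae_of_all _ hpt)
  have hinner : Γ * ‖v‖ ^ 2 ≤ ⟪v, g⟫ := by
    have h2 : (⟪v, g⟫ : ℝ) = ∫ x, (f x - m.γ * ∫ y, f y ∂m.stateActionKernel π x) * f x ∂d := by
      rw [hgd, ← integral_inner hint]
      simp_rw [real_inner_smul_right, hf]
    have h3 := coercive_occupancy (κ := m.stateActionKernel π) (ν := β) h0.le h1 hfb
    have hf2 : BddMeas fun x => f x ^ 2 := by simpa only [sq] using hfb.mul hfb
    have h4 := mul_integral_le_integral_occupancy (κ := m.stateActionKernel π) (ν := β) h0.le h1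
      hf2 fun x => sq_nonneg _
    have h5 := minEigenvalue_mul_le hφ hb β v
    have h6 : 0 ≤ 1 - √m.γ := by
      rw [sub_nonneg, Real.sqrt_le_iff]
      exact ⟨zero_le_one, by simpa using h1.le⟩
    rw [h2]
    refine le_trans ?_ h3
    calc Γ * ‖v‖ ^ 2 = (1 - √m.γ) * ((1 - m.γ) * (minEigenvalue φ β * ‖v‖ ^ 2)) := by
          rw [hΓ, gammaConst]; ring
      _ ≤ (1 - √m.γ) * ((1 - m.γ) * ∫ x, f x ^ 2 ∂β) := by
          have := sub_pos.2 h1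
          gcongr
      _ ≤ _ := mul_le_mul_of_nonneg_left h4 h6
  have hsq : ‖θ - h • g - θπ‖ ^ 2 ≤ (Real.exp (-(h * Γ / 2)) * ‖v‖) ^ 2 := by
    have h2 : θ - h • g - θπ = v - h • g := by rw [hv]; abel
    have h3 : h * (2 * (1 + m.γ)) < Γ := (lt_div_iff₀ (by positivity)).1 h_small
    have h4 : ‖g‖ ^ 2 ≤ ((1 + m.γ) * ‖v‖) ^ 2 := pow_le_pow_left₀ (norm_nonneg _) hgn 2
    have h5 := Real.add_one_le_exp (-(h * Γ))
    have h6 : Real.exp (-(h * Γ / 2)) ^ 2 = Real.exp (-(h * Γ)) := by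
      rw [← Real.exp_nat_mul]
      congr 1
      push_cast
      ring
    -- Since `1 + γ < 2`, the step-size bound gives this. The quadratic term then uses up half of
    -- the gain `2hΓ`, leaving the factor `1 - hΓ ≤ exp(-hΓ)` for the squared norm.
    have h7 : h * (1 + m.γ) ^ 2 ≤ Γ := by
      have := mul_pos (mul_pos h_pos (by linarith : 0 < 1 + m.γ)) (sub_pos.2 h1)
      linarith
    have h8 : h ^ 2 * ‖g‖ ^ 2 ≤ h * Γ * ‖v‖ ^ 2 := by
      calc h ^ 2 * ‖g‖ ^ 2 ≤ h ^ 2 * ((1 + m.γ) * ‖v‖) ^ 2 := by gcongr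
        _ = h * (h * (1 + m.γ) ^ 2) * ‖v‖ ^ 2 := by ring
        _ ≤ h * Γ * ‖v‖ ^ 2 := by gcongr
    rw [h2, norm_sub_sq_real, real_inner_smul_right, norm_smul, mul_pow, mul_pow, h6,
      Real.norm_eq_abs, sq_abs]
    have h9 := mul_le_mul_of_nonneg_right h5 (sq_nonneg ‖v‖)
    have h10 := mul_le_mul_of_nonneg_left hinner h_pos.le
    linarith
  exact le_of_sq_le_sq hsq (by positivity)

theorem norm_critic_iterate_le (hφ : Measurable φ) (hb : ∀ x, ‖φ x‖ ≤ 1) (β : Measure (S × A))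
    [IsProbabilityMeasure β] (hπ : π ∈ m.admissible)
    {θπ : EuclideanSpace ℝ (Fin N)} (hθ : ∀ x, m.qValue π x = ⟪θπ, φ x⟫)
    {h : ℝ} (h_pos : 0 < h) (h_small : h < m.gammaConst φ β / (2 * (1 + m.γ)))
    (θ : EuclideanSpace ℝ (Fin N)) (k : ℕ) :
    ‖(fun t => t - h • m.semiGradient φ β t π)^[k] θ - θπ‖
      ≤ Real.exp (-(h * m.gammaConst φ β / 2)) ^ k * ‖θ - θπ‖ := by
  induction k with
  | zero => simp
  | succ k ih =>
    rw [Function.iterate_succ_apply', pow_succ', mul_assoc]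
    exact (norm_critic_step_le hφ hb β hπ hθ h_pos h_small _).trans
      (mul_le_mul_of_nonneg_left ih (Real.exp_pos _).le)

end EntropyMDP

/-! ### Scalar recursions. -/

-- A homogeneous rate strictly below the forcing rate `a` is dominated by it: `B/(a-r)` absorbs the
-- forcing, and the finite sum covers the indices before the recursion holds.
open Filter in
theorem exists_le_mul_pow_of_le {z : ℕ → ℝ} {r a B : ℝ} (hr : 0 ≤ r) (hra : r < a) (hB : 0 ≤ B)
    (h : ∀ᶠ n in atTop, z (n + 1) ≤ r * z n + B * a ^ n) :
    ∃ b, 0 ≤ b ∧ ∀ n, z n ≤ b * a ^ n := by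
  have ha : 0 < a := hr.trans_lt hra
  obtain ⟨n₀, hn₀⟩ := eventually_atTop.1 h
  set b := ∑ k ∈ Finset.range (n₀ + 1), |z k| / a ^ k + B / (a - r) with hb
  have hs0 : ∀ k ∈ Finset.range (n₀ + 1), 0 ≤ |z k| / a ^ k := fun k _ => by positivity
  have hB' : 0 ≤ B / (a - r) := div_nonneg hB (sub_nonneg.2 hra.le)
  have hinit : ∀ n ≤ n₀, z n ≤ b * a ^ n := fun n hn => by
    rw [← div_le_iff₀ (pow_pos ha n)]
    have h1 := Finset.single_le_sum hs0 (Finset.mem_range.2 (Nat.lt_succ_of_le hn))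
    have h2 : z n / a ^ n ≤ |z n| / a ^ n := by gcongr; exact le_abs_self _
    linarith
  have hbB : B ≤ b * (a - r) := by
    rw [← div_le_iff₀ (sub_pos.2 hra), hb]
    linarith [Finset.sum_nonneg hs0]
  refine ⟨b, add_nonneg (Finset.sum_nonneg hs0) hB', fun n => ?_⟩
  induction n with
  | zero => exact hinit 0 (Nat.zero_le _)
  | succ n ih =>
    by_cases hn : n + 1 ≤ n₀
    · exact hinit _ hn
    · have h1 := hn₀ n (by omega)
      have h2 := mul_le_mul_of_nonneg_left ih hr
      have h3 := mul_le_mul_of_nonneg_right hbB (pow_pos ha n).le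
      rw [pow_succ]
      linarith

open Filter in
/-- Convergence of the coupled recursion between the distance `g` to the optimum, the improvement
gap `p` and the critic error `e`. -/
theorem exists_add_le_mul_pow {g p e : ℕ → ℝ} {α γ K K' C τ a : ℝ}
    (hg0 : ∀ n, 0 ≤ g n) (hp0 : ∀ n, 0 ≤ p n) (he0 : ∀ n, 0 ≤ e n)
    (hα0 : 0 < α) (hα1 : α ≤ 1) (hγ0 : 0 < γ) (hγ1 : γ < 1) (hK : 0 ≤ K) (hK' : 0 ≤ K')
    (hτ : 0 < τ) (ha1 : a < 1) (hαa : 1 - α < a)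
    (hp : ∀ n, p (n + 1) ≤ (1 - α) * p n + K * e n)
    (hg : ∀ n, g (n + 1) ≤ (1 - α) * g n + α * (γ * (p n + g n)) + α * e n)
    (hg' : ∀ n, g n ≤ τ → g (n + 1) ≤ (1 - α) * g n + α * (C * g n ^ 2) + α * e n)
    (he : ∀ n, e (n + 1)
      ≤ a ^ (n + 2) * (e n + K' * (p n + g n + (p (n + 1) + g (n + 1))))) :
    ∃ b, 0 ≤ b ∧ ∀ n, p n + g n ≤ b * a ^ n := by
  have ha0 : 0 < a := by linarith
  -- The slow contraction rate `1 - δ` of `p + g` available globally.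
  set δ := α * (1 - γ) with hδ
  have hδ0 : 0 < δ := mul_pos hα0 (sub_pos.2 hγ1)
  have hδ1 : δ ≤ 1 := by nlinarith
  have hX : ∀ n, p (n + 1) + g (n + 1) ≤ (1 - δ) * (p n + g n) + (1 + K) * e n := fun n => by
    have h1 : α * e n ≤ e n := mul_le_of_le_one_left (he0 n) hα1
    have h2 := hp n
    have h3 := hg n
    rw [hδ]
    linarith
  set K₃ := 1 + K' * (3 + K) with hK₃
  have hK₃0 : 0 < K₃ := by positivity
  have he' : ∀ n, e (n + 1) ≤ a ^ (n + 2) * K₃ * (e n + (p n + g n)) := fun n => by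
    refine (he n).trans ?_
    rw [mul_assoc]
    refine mul_le_mul_of_nonneg_left ?_ (pow_pos ha0 _).le
    have hXn : 0 ≤ p n + g n := add_nonneg (hp0 n) (hg0 n)
    have h1 : p n + g n + (p (n + 1) + g (n + 1)) ≤ (3 + K) * (e n + (p n + g n)) := by
      have := hX n
      have h2 := mul_nonneg hδ0.le hXn
      have h3 := mul_nonneg hK hXn
      have := he0 n
      linarith
    have h4 := mul_le_mul_of_nonneg_left h1 hK'
    rw [hK₃]
    linarith
  -- Weight of a Lyapunov function: as `1 - δ/2 ≥ 1/2`, a fraction `1 - δ/2` of `F e` dominates the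
  -- term `(1+K) e` and the small feedback, whose coefficient tends to zero.
  set F := 4 * (1 + K) with hF
  set Y : ℕ → ℝ := fun n => p n + g n + F * e n with hY
  have hpow : Tendsto (fun n : ℕ => F * (a ^ (n + 2) * K₃)) atTop (nhds 0) := by
    have := (((tendsto_pow_atTop_nhds_zero_of_lt_one ha0.le ha1).comp
      (tendsto_add_atTop_nat 2)).mul_const K₃).const_mul F
    simpa using this
  have hYstep : ∀ᶠ n in atTop, Y (n + 1) ≤ (1 - δ / 2) * Y n + 0 * (1 - δ / 4) ^ n := by
    filter_upwards [hpow.eventually (gt_mem_nhds (half_pos hδ0))] with n hn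
    have hXn : 0 ≤ p n + g n := add_nonneg (hp0 n) (hg0 n)
    have h1 := mul_le_mul_of_nonneg_left (he' n) (by positivity : 0 ≤ F)
    have h2 := mul_le_mul_of_nonneg_right hn.le (add_nonneg (he0 n) hXn)
    have h3 := hX n
    have h4 : 0 ≤ (1 - δ) * K * e n := mul_nonneg (mul_nonneg (by linarith) hK) (he0 n)
    have h5 : 0 ≤ (1 - δ) * e n := mul_nonneg (by linarith) (he0 n)
    have h6 : 0 ≤ K * e n := mul_nonneg hK (he0 n)
    have h7 := he0 n
    simp only [hY]
    rw [hF] at h1 h2 ⊢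
    linarith
  obtain ⟨b, hb0, hb⟩ := exists_le_mul_pow_of_le (by linarith : 0 ≤ 1 - δ / 2)
    (by linarith : 1 - δ / 2 < 1 - δ / 4) le_rfl hYstep
  have hpowδ : Tendsto (fun n : ℕ => b * (1 - δ / 4) ^ n) atTop (nhds 0) := by
    simpa using (tendsto_pow_atTop_nhds_zero_of_lt_one (by linarith : 0 ≤ 1 - δ / 4)
      (by linarith)).const_mul b
  have heY : ∀ n, e n + (p n + g n) ≤ b := fun n => by
    have h1 : b * (1 - δ / 4) ^ n ≤ b :=
      mul_le_of_le_one_right hb0 (pow_le_one₀ (by linarith) (by linarith))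
    have h2 := hb n
    have h3 := he0 n
    have h4 := mul_nonneg hK h3
    simp only [hY, hF] at h2
    linarith
  set B := e 0 + K₃ * b with hBdef
  have hB0 : 0 ≤ B := add_nonneg (he0 0) (mul_nonneg hK₃0.le hb0)
  have heB : ∀ n, e n ≤ B * a ^ n := fun n => by
    cases n with
    | zero => simpa [hBdef] using mul_nonneg hK₃0.le hb0
    | succ n =>
      have hpn : 0 < a ^ (n + 1) := pow_pos ha0 _
      have h1 : a ^ (n + 2) ≤ a ^ (n + 1) := pow_le_pow_of_le_one ha0.le ha1.le (by omega)
      calc e (n + 1) ≤ a ^ (n + 2) * K₃ * (e n + (p n + g n)) := he' n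
        _ ≤ a ^ (n + 1) * K₃ * b := by
          have := add_nonneg (he0 n) (add_nonneg (hp0 n) (hg0 n))
          gcongr
          exact heY n
        _ ≤ B * a ^ (n + 1) := by
          rw [hBdef]
          have := mul_nonneg (he0 0) hpn.le
          linarith
  have hg_lim : Tendsto g atTop (nhds 0) := squeeze_zero hg0 (fun n => by
    have h1 := hb n
    have h2 : 0 ≤ F * e n := mul_nonneg (by positivity) (he0 n)
    simp only [hY] at h1
    linarith [hp0 n]) hpowδ
  have hCg : Tendsto (fun n => α * (C * g n)) atTop (nhds 0) := by
    simpa using (hg_lim.const_mul C).const_mul α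
  -- Bootstrap: convergence at the slow rate makes `αC g` smaller than half the gap `a - (1-α)`, so
  -- the quadratic term only moves the rate from `1-α` to the midpoint, still below `a`.
  have hgstep : ∀ᶠ n in atTop, g (n + 1) ≤ ((1 - α + a) / 2) * g n + B * a ^ n := by
    filter_upwards [hg_lim.eventually (gt_mem_nhds hτ),
      hCg.eventually (gt_mem_nhds (by linarith : 0 < (a - (1 - α)) / 2))] with n h1 h2
    have h3 := hg' n h1.le
    have h4 := mul_le_mul_of_nonneg_right h2.le (hg0 n)
    have h5 : α * e n ≤ e n := mul_le_of_le_one_left (he0 n) hα1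
    have h6 := heB n
    linarith
  have hpstep : ∀ᶠ n in atTop, p (n + 1) ≤ (1 - α) * p n + K * B * a ^ n :=
    Eventually.of_forall fun n => by
      have h1 := mul_le_mul_of_nonneg_left (heB n) hK
      linarith [hp n]
  obtain ⟨b₁, hb₁0, hb₁⟩ := exists_le_mul_pow_of_le (by linarith) (by linarith) hB0 hgstep
  obtain ⟨b₂, hb₂0, hb₂⟩ := exists_le_mul_pow_of_le (by linarith) hαa (mul_nonneg hK hB0) hpstep
  exact ⟨b₂ + b₁, add_nonneg hb₂0 hb₁0, fun n => by rw [add_mul]; exact add_le_add (hb₂ n) (hb₁ n)⟩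

/-! ### The iterates of the double loop. -/

namespace EntropyMDP

variable {S A : Type*} [MeasurableSpace S] [MeasurableSpace A] {m : EntropyMDP S A}
  {N : ℕ} {φ : S × A → EuclideanSpace ℝ (Fin N)} {β : Measure (S × A)} {ρ : Measure S}
  {h lam : ℝ} {M : ℕ → ℕ} {θ : ℕ → EuclideanSpace ℝ (Fin N)} {π : ℕ → Policy S A}

instance (p : Policy S A) : IsMarkovKernel (m.stateKernel p) := by
  unfold stateKernel; infer_instance

/-- The log-densities of the iterates are running averages of the critics. -/
def potential (m : EntropyMDP S A) (φ : S × A → EuclideanSpace ℝ (Fin N)) (lam : ℝ)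
    (θ : ℕ → EuclideanSpace ℝ (Fin N)) (G₀ : S × A → ℝ) : ℕ → S × A → ℝ
  | 0 => G₀
  | n + 1 => fun x =>
      (1 - m.τ * lam) * potential m φ lam θ G₀ n x + m.τ * lam * ⟪θ (n + 1), φ x⟫

theorem IsDoubleLoop.isGibbs (hφ : Measurable φ) (hb : ∀ x, ‖φ x‖ ≤ 1) (hlam : 0 < lam)
    (hit : m.IsDoubleLoop φ β ρ h lam M θ π) {G₀ : S × A → ℝ} (hG₀ : m.IsGibbs (π 0) G₀) (n : ℕ) :
    m.IsGibbs (π n) (potential m φ lam θ G₀ n) := by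
  induction n with
  | zero => exact hG₀
  | succ n ih =>
    exact ih.actor_step hφ hb (θ (n + 1)) hlam (hit.actor_mem n) (hit.actor_pointwise n)

/-- The values of the iterates converge uniformly and linearly to the soft optimal value. -/
theorem IsDoubleLoop.exists_realValue_le (hφ : Measurable φ) (hb : ∀ x, ‖φ x‖ ≤ 1)
    [IsProbabilityMeasure β] (h_realisable : m.Realisable φ)
    (h_eigenvalue : 0 < minEigenvalue φ β) (h_pos : 0 < h)
    (h_small : h < m.gammaConst φ β / (2 * (1 + m.γ))) (hlam : 0 < lam)
    (hα1 : m.τ * lam ≤ 1) {a : ℝ} (ha1 : a < 1) (hαa : 1 - m.τ * lam < a)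
    (hM : ∀ n, Real.exp (-(h * m.gammaConst φ β / 2)) ^ M n ≤ a ^ (n + 1))
    (hit : m.IsDoubleLoop φ β ρ h lam M θ π) {Q : S × A → ℝ} (hQ : m.IsSoftOptimal Q) :
    ∃ b, 0 ≤ b ∧ ∀ n s, m.realValue (π n) s
      ≤ freeEnergy m.μ m.τ (fun a => Q (s, a)) + b * a ^ n := by
  have hγ0 := m.γ_pos
  have hγ1 := m.γ_lt_one
  have hτ := m.τ_pos
  have hγ' : 0 < 1 - m.γ := sub_pos.2 hγ1
  obtain ⟨G₀, hG₀⟩ := exists_isGibbs hit.init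
  have hG := hit.isGibbs hφ hb hlam hG₀
  set G := potential m φ lam θ G₀ with hGdef
  set α := m.τ * lam with hα
  have hα0 : 0 < α := mul_pos hτ hlam
  have hGsucc : ∀ n x, G (n + 1) x = (1 - α) * G n x + α * ⟪θ (n + 1), φ x⟫ := fun n x => rfl
  choose θπ hθπ using fun n => h_realisable (π n) (hG n).mem_admissible
  set e : ℕ → ℝ := fun n => ‖θ (n + 1) - θπ n‖ with he
  set g : ℕ → ℝ := fun n => ⨆ x, |G n x - Q x| with hg
  set p : ℕ → ℝ := fun n => ⨆ x, |max (m.qValue (π n) x - G n x) 0| with hp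
  have hg0 : ∀ n, 0 ≤ g n := fun n => Real.iSup_nonneg fun x => abs_nonneg _
  have hp0 : ∀ n, 0 ≤ p n := fun n => Real.iSup_nonneg fun x => abs_nonneg _
  have he0 : ∀ n, 0 ≤ e n := fun n => norm_nonneg _
  have hGQ : ∀ n x, |G n x - Q x| ≤ g n := fun n => ((hG n).1.sub hQ.1).abs_le_iSup
  have hQG : ∀ n x, m.qValue (π n) x ≤ G n x + p n := fun n x => by
    have h1 := ((hG n).bddMeas_qValue.sub (hG n).1).max_zero.abs_le_iSup x
    have h2 := (le_max_left _ 0).trans ((le_abs_self _).trans h1)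
    linarith
  have hq : ∀ n x, |⟪θ (n + 1), φ x⟫ - m.qValue (π n) x| ≤ e n := fun n x => by
    rw [hθπ, ← inner_sub_left]
    exact (abs_real_inner_le_norm _ _).trans (mul_le_of_le_one_right (norm_nonneg _) (hb x))
  have hqb : ∀ n, BddMeas fun x => (⟪θ (n + 1), φ x⟫ : ℝ) := fun n => bddMeas_inner hφ hb _
  have hV : ∀ n s, m.realValue (π n) s
      ≤ freeEnergy m.μ m.τ (fun a => Q (s, a)) + (p n + g n) := fun n =>
    hQ.realValue_le_add (hG n) (hQG n) (hGQ n)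
  have hQle : ∀ n x, m.qValue (π n) x ≤ Q x + m.γ * (p n + g n) := fun n =>
    hQ.qValue_le_add (hG n) (hV n)
  have hleQ : ∀ n x, Q x ≤ m.qValue (π n) x := fun n => hQ.le_qValue (hG n)
  -- `Gₙ₊₁ - Q = (1-α)(Gₙ - Q) + α(qₙ - Q^{πⁿ}) + α(Q^{πⁿ} - Q)`, with the last bracket in `[0, b]`.
  -- The bound `b` is left free so that the linear and the quadratic estimates can both be inserted.
  have hgstep : ∀ n b, (∀ x, m.qValue (π n) x ≤ Q x + b) →
      g (n + 1) ≤ (1 - α) * g n + α * b + α * e n := fun n b hle => by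
    have hne : Nonempty (S × A) := nonempty_of_isProbabilityMeasure β
    refine ciSup_le fun x => ?_
    have h1 := mul_le_mul_of_nonneg_left (abs_le.1 (hGQ n x)).1 (sub_nonneg.2 hα1)
    have h2 := mul_le_mul_of_nonneg_left (abs_le.1 (hGQ n x)).2 (sub_nonneg.2 hα1)
    have h3 := mul_le_mul_of_nonneg_left (abs_le.1 (hq n x)).1 hα0.le
    have h4 := mul_le_mul_of_nonneg_left (abs_le.1 (hq n x)).2 hα0.le
    have h5 := mul_le_mul_of_nonneg_left (hle x) hα0.le
    have h6 := mul_le_mul_of_nonneg_left (hleQ n x) hα0.le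
    have h7 : 0 ≤ α * b := mul_nonneg hα0.le (by linarith [hle x, hleQ n x])
    rw [hGsucc, abs_le]
    constructor <;> linarith
  have hgp : ∀ n, g (n + 1) ≤ (1 - α) * g n + α * (m.γ * (p n + g n)) + α * e n := fun n =>
    hgstep n _ (hQle n)
  have hgq : ∀ n, g n ≤ m.τ →
      g (n + 1) ≤ (1 - α) * g n + α * (m.γ / (m.τ * (1 - m.γ)) * g n ^ 2) + α * e n :=
    fun n hn => hgstep n _ fun x => by
      have h1 := hQ.qValue_le_add (hG n) (hQ.realValue_le_add_sq (hG n) (hGQ n) hn) x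
      have h2 : m.γ * (g n ^ 2 / m.τ / (1 - m.γ)) = m.γ / (m.τ * (1 - m.γ)) * g n ^ 2 := by
        field_simp
      linarith
  have hpstep : ∀ n, p (n + 1) ≤ (1 - α) * p n + (m.γ * (2 / (1 - m.γ)) + 1) * e n := fun n => by
    have hne : Nonempty (S × A) := nonempty_of_isProbabilityMeasure β
    have hnn : 0 ≤ m.γ * (2 / (1 - m.γ)) := by positivity
    refine ciSup_le fun x => ?_
    rw [abs_of_nonneg (le_max_right _ _)]
    refine max_le ?_ (add_nonneg (mul_nonneg (sub_nonneg.2 hα1) (hp0 n))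
      (mul_nonneg (by linarith) (he0 n)))
    have h1 := (hG n).qValue_step_le hα0 hα1 (hqb n) (hG (n + 1)) (hq n) x
    have h2 := mul_le_mul_of_nonneg_left (hQG n x) (sub_nonneg.2 hα1)
    have h3 := mul_le_mul_of_nonneg_left (abs_le.1 (hq n x)).1 hα0.le
    have h4 : α * e n ≤ e n := mul_le_of_le_one_left (he0 n) hα1
    have h5 : m.γ * (2 * e n / (1 - m.γ)) = m.γ * (2 / (1 - m.γ)) * e n := by ring
    rw [hGsucc]
    linarith
  -- Warm start: the critic of round `n + 1` begins at `θⁿ⁺¹`, so its initial error is `eₙ` plus the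
  -- drift of the true parameter, controlled through `λ_β`. The exponent `n + 2` comes from `M (n +
  -- 1)`.
  have hestep : ∀ n, e (n + 1) ≤ a ^ (n + 2) *
      (e n + m.γ / √(minEigenvalue φ β) * (p n + g n + (p (n + 1) + g (n + 1)))) := fun n => by
    have hs : 0 < √(minEigenvalue φ β) := Real.sqrt_pos.2 h_eigenvalue
    have hX : ∀ n, 0 ≤ m.γ * (p n + g n) := fun n =>
      mul_nonneg hγ0.le (add_nonneg (hp0 n) (hg0 n))
    have h1 : √(minEigenvalue φ β) * ‖θπ n - θπ (n + 1)‖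
        ≤ m.γ * (p n + g n + (p (n + 1) + g (n + 1))) := by
      refine sqrt_minEigenvalue_mul_norm_le hφ hb β fun x => ?_
      rw [inner_sub_left, ← hθπ, ← hθπ, abs_le]
      constructor <;>
        linarith [hQle n x, hleQ n x, hQle (n + 1) x, hleQ (n + 1) x, hX n, hX (n + 1)]
    have h2 : ‖θπ n - θπ (n + 1)‖
        ≤ m.γ / √(minEigenvalue φ β) * (p n + g n + (p (n + 1) + g (n + 1))) := by
      rw [div_mul_eq_mul_div, le_div_iff₀ hs]
      linarith
    have h3 := norm_critic_iterate_le hφ hb β (hG (n + 1)).mem_admissible (hθπ (n + 1)) h_pos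
      h_small (θ (n + 1)) (M (n + 1))
    rw [← hit.critic (n + 1)] at h3
    have h4 : ‖θ (n + 1) - θπ (n + 1)‖ ≤ e n + ‖θπ n - θπ (n + 1)‖ :=
      norm_sub_le_norm_sub_add_norm_sub _ _ _
    refine h3.trans (mul_le_mul (hM (n + 1)) (h4.trans (by linarith)) (norm_nonneg _) ?_)
    exact (pow_pos (by linarith : 0 < a) _).le
  obtain ⟨b, hb0, hb'⟩ := exists_add_le_mul_pow hg0 hp0 he0 hα0 hα1 hγ0 hγ1 (by positivity)
    (by positivity) hτ ha1 hαa hpstep hgp hgq hestep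
  exact ⟨b, hb0, fun n s => (hV n s).trans (by linarith [hb' n])⟩

end EntropyMDP

end

/-! ### The main theorem. -/

theorem mainTheorem1
    {S A : Type*}
    [TopologicalSpace S] [PolishSpace S] [MeasurableSpace S] [BorelSpace S]
    [TopologicalSpace A] [PolishSpace A] [MeasurableSpace A] [BorelSpace A]
    (m : EntropyMDP S A)
    {N : ℕ} (φ : S × A → EuclideanSpace ℝ (Fin N)) (hφ_meas : Measurable φ)
    (β : Measure (S × A)) [IsProbabilityMeasure β]
    (h_realisable : m.Realisable φ)
    (h_eigenvalue : 0 < minEigenvalue φ β)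
    (h_bounded : ∀ x, ‖φ x‖ ≤ 1)
    (ρ : Measure S) [IsProbabilityMeasure ρ]
    (πstar : Policy S A) (h_opt : m.IsOptimal πstar ρ)
    (ξ : ℝ)
    (h_ac : occupancy m.γ (m.stateKernel πstar) ρ ≪ ρ)
    (h_conc : ∀ᵐ s ∂ρ,
      (occupancy m.γ (m.stateKernel πstar) ρ).rnDeriv ρ s ≤ ENNReal.ofReal ξ)
    (h lam : ℝ) (h_pos : 0 < h) (h_small : h < m.gammaConst φ β / (2 * (1 + m.γ)))
    (lam_pos : 0 < lam)
    (h_step_nonneg : 0 ≤ 1 - m.τ * lam) (h_step : 1 - m.τ * lam ≤ (ξ - 1) / ξ)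
    (c : ℝ) (hc : 0 < c)
    (M : ℕ → ℕ) (hM : ∀ n : ℕ, 4 * c / (h * m.gammaConst φ β) * ((n : ℝ) + 1) ≤ (M n : ℝ))
    (θ : ℕ → EuclideanSpace ℝ (Fin N)) (π : ℕ → Policy S A)
    (h_iter : m.IsDoubleLoop φ β ρ h lam M θ π) :
    m.valueAt πstar ρ ≠ ⊤ ∧
    ∃ b : ℝ, 0 ≤ b ∧ ∀ n : ℕ,
      m.valueAt (π n) ρ - m.valueAt πstar ρ
        ≤ ((b * Real.exp (-(min (1 / ξ) c) * (n : ℝ)) : ℝ) : EReal) := by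
  have hξ := one_le_of_rnDeriv_occupancy_le m.γ_pos.le m.γ_lt_one h_ac h_conc
  have hξ0 : 0 < ξ := by linarith
  have hmin : 0 < min (1 / ξ) c := lt_min (by positivity) hc
  set a := Real.exp (-min (1 / ξ) c) with ha
  have ha1 : a < 1 := (Real.exp_lt_exp.2 (neg_lt_zero.2 hmin)).trans_eq Real.exp_zero
  -- Strictness comes from `1 + x < exp x` at `x = -1/ξ ≠ 0`.
  have hαa : 1 - m.τ * lam < a := by
    have h1 : (ξ - 1) / ξ = -(1 / ξ) + 1 := by field_simp; ring
    have h2 := Real.add_one_lt_exp (x := -(1 / ξ)) (by simp [hξ0.ne'])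
    have h3 : Real.exp (-(1 / ξ)) ≤ a := Real.exp_le_exp.2 (neg_le_neg (min_le_left _ _))
    linarith
  have hΓ : 0 < m.gammaConst φ β := by
    have h1 : h * (2 * (1 + m.γ)) < m.gammaConst φ β :=
      (lt_div_iff₀ (by linarith [m.γ_pos])).1 h_small
    exact lt_trans (mul_pos h_pos (by linarith [m.γ_pos])) h1
  have hM' : ∀ n, Real.exp (-(h * m.gammaConst φ β / 2)) ^ M n ≤ a ^ (n + 1) := fun n => by
    rw [ha, ← Real.exp_nat_mul, ← Real.exp_nat_mul, Real.exp_le_exp]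
    have h1 := hM n
    rw [div_mul_eq_mul_div, div_le_iff₀ (mul_pos h_pos hΓ)] at h1
    have h2 : min (1 / ξ) c * ((n : ℝ) + 1) ≤ 2 * c * ((n : ℝ) + 1) := by
      have h3 := min_le_right (1 / ξ) c
      gcongr
      linarith
    push_cast
    linarith
  obtain ⟨Q, hQ⟩ := m.exists_isSoftOptimal
  obtain ⟨b, hb0, hb⟩ := h_iter.exists_realValue_le hφ_meas h_bounded h_realisable h_eigenvalue
    h_pos h_small lam_pos (by linarith) ha1 hαa hM' hQ
  have hadm : ∀ n, π n ∈ m.admissible := fun n => by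
    cases n with
    | zero => exact h_iter.init
    | succ n => exact h_iter.actor_mem n
  refine ⟨?_, b, hb0, fun n => ?_⟩
  · have h1 : m.valueAt πstar ρ ≤ m.valueAt (π 0) ρ := by
      rw [h_opt]
      exact iInf_le _ _
    rw [(EntropyMDP.admissible_value (hadm 0)).2.1 ρ inferInstance] at h1
    exact (h1.trans_lt (EReal.coe_lt_top _)).ne
  · obtain ⟨hVb, hV, -⟩ := EntropyMDP.admissible_value (hadm n)
    have hW := hQ.1.freeEnergy_section (μ := m.μ) m.τ_pos
    have h1 := integral_le_of_forall_le (ν := ρ) ((hVb.sub hW).integrable ρ)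
      (fun s => sub_le_iff_le_add'.2 (hb n s))
    rw [integral_sub (hVb.integrable ρ) (hW.integrable ρ)] at h1
    rw [hV ρ inferInstance]
    -- The optimal value is replaced by its real lower bound, so that the difference is one of real
    -- numbers.
    refine (EReal.sub_le_sub le_rfl (hQ.le_valueAt πstar ρ)).trans ?_
    rw [← EReal.coe_sub, EReal.coe_le_coe_iff]
    have h2 : Real.exp (-(min (1 / ξ) c) * (n : ℝ)) = a ^ n := by
      rw [ha, ← Real.exp_nat_mul]
      ring_nf
    rwa [h2]
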